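/- Let $n\ge 2$ and $N\ge 0$. Let $\widehat{\mathscr T}$ be an $n$-dimensional oriented polyhedral complex (cells are polyhedra with finitely many faces, the intersection of two cells is empty or a common face, $\partial\tau=\sum_\sigma[\tau:\sigma]\sigma$ with $[\tau:\sigma]=\pm1$ for the hyperfaces $\sigma$ of $\tau$) with a free cocompact action of a group $\pi$ preserving the oriented cell structure; for instance the lift of a polyhedral decomposition $\mathscr T$ of a closed $n$-manifold $M$ to the covering of $M$ given by a quotient $\pi$ of $\pi_1(M)$. Assume that * every $(n-1)$-cell has exactly $N$ hyperfaces and is a hyperface of exactly two $n$-cells; * any two hyperfaces of an $n$-cell have a common $(n-2)$-dimensional face (this holds for all triangulations, where $N=n$). Let $c_{n-1}$ be the number of $\pi$-orbits of $(n-1)$-cells. Let $C^{(2)}_k$ be the Hilbert space with orthonormal basis the $k$-cells of $\widehat{\mathscr T}$, let $\Delta^{(2)}_{n-1}=\partial\partial^\star+\partial^\star\partial$ on $C^{(2)}_{n-1}$, and let $b^{(2)}_{n-1}=\dim_{\mathrm{vN}}\ker\Delta^{(2)}_{n-1}=\operatorname{tr}_{\mathrm{vN}}\Pi_{\ker\Delta^{(2)}_{n-1}}$,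 where $\operatorname{tr}_{\mathrm{vN}}P=\sum_i\langle P\hat\sigma_i,\hat\sigma_i\rangle$ over representatives $\hat\sigma_i$ of the $\pi$-orbits of $(n-1)$-cells; this is $b^{(2)}_{n-1}(M,\pi)$ for a covering of $M$ as above. Two $(n-1)$-cells are admissible if they share an $(n-2)$-face and do not bound a common $n$-cell; they are compatible if the common face has opposite signs in their boundaries. A closed geodesic of length $m=|\gamma|\ge1$ is a cyclic sequence $\gamma=(\sigma_1,\dots,\sigma_m)$ of $(n-1)$-cells, up to cyclic permutation, with all consecutive pairs (including $(\sigma_m,\sigma_1)$) admissible; it is primitive if it is not a proper power; $\varepsilon_\gamma=(-1)^{n_\gamma}$, where $n_\gamma$ is the number of non-compatible consecutive pairs. Put $$\zeta_{\widehat{\mathscr T}}(z)=\prod_{[\gamma]}\bigl(1-\varepsilon_\gamma z^{|\gamma|}\bigr)^{1/r_\gamma},$$ the product being over the $\pi$-orbits of primitive closed geodesics $\gamma$ of $\widehat{\mathscr T}$ (equivalently, each is counted once, by a representative starting in a fundamental domain), where $r_\gamma$ is the (finite) order of the stabilizer of $\gamma$ in $\pi$ and the power is the principal one. If $\pi$ is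 torsion free, then all $r_\gamma=1$. Then the product converges for all $z\in\mathbb C$ in a neighbourhood of $0$, and, for given $N$, the function $\zeta_{\widehat{\mathscr T}}$ and the number $c_{n-1}$ determine $b^{(2)}_{n-1}$, without any determinant-class assumption: if $(\widehat{\mathscr T},\pi)$ and $(\widehat{\mathscr T}',\pi')$ are as above, of dimensions $n,n'\ge2$ and with the same $N$, if $\zeta_{\widehat{\mathscr T}}=\zeta_{\widehat{\mathscr T}'}$ near $0$ and $c_{n-1}=c'_{n'-1}$, then $$b^{(2)}_{n-1}(\widehat{\mathscr T},\pi)=b^{(2)}_{n'-1}(\widehat{\mathscr T}',\pi').$$ -/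

import Mathlib

open scoped Topology

/-- An oriented polyhedral complex of dimension at most `n`, given by its cells `X`, ordered by
`σ ≤ τ` iff `σ` is a face of `τ`, and by the incidence numbers `inc τ σ`, the coefficient of `σ`
in the boundary `∂τ`. -/
structure PolyhedralComplex (X : Type*) [PartialOrder X] (n : ℕ) where
  /-- The dimension of a cell. -/
  dim : X → ℕ
  dim_le : ∀ σ, dim σ ≤ n
  /-- Proper faces have smaller dimension. -/
  dim_lt : ∀ {σ τ : X}, σ < τ → dim σ < dim τ
  /-- Face posets are graded by the dimension. -/
  exists_between : ∀ {σ τ : X}, σ < τ → ∃ ρ, σ < ρ ∧ ρ ≤ τ ∧ dim ρ = dim σ + 1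
  /-- A polyhedron has finitely many faces. -/
  finite_faces : ∀ τ : X, (Set.Iic τ).Finite
  /-- The intersection of two polyhedra is empty or a common face of both. -/
  exists_inter : ∀ {ρ σ τ : X}, ρ ≤ σ → ρ ≤ τ → ∃ μ, IsGreatest (Set.Iic σ ∩ Set.Iic τ) μ
  /-- A codimension two face of a polyhedron lies in exactly two of its hyperfaces. -/
  diamond : ∀ {ρ τ : X}, ρ ≤ τ → dim τ = dim ρ + 2 → (Set.Ioo ρ τ).ncard = 2
  /-- The incidence numbers, coming from the choice of an orientation of each cell. -/
  inc : X → X → ℤ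
  inc_hyperface : ∀ {τ σ : X}, σ < τ → dim τ = dim σ + 1 → inc τ σ = 1 ∨ inc τ σ = -1
  inc_eq_zero : ∀ {τ σ : X}, ¬(σ < τ ∧ dim τ = dim σ + 1) → inc τ σ = 0
  /-- `∂ ∘ ∂ = 0`. -/
  boundary_boundary : ∀ τ ρ : X, ∑ᶠ σ, inc τ σ * inc σ ρ = 0

/-- A polyhedral complex with a free cocompact action of the group `π` by automorphisms that
preserve the orientations of the cells (the lift of a polyhedral decomposition of a compact space to
a covering with deck group `π`). -/
structure CocompactPolyhedralComplex (π X : Type*) [Group π] [PartialOrder X] [MulAction π X]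
    (n : ℕ) extends PolyhedralComplex X n where
  smul_le_smul : ∀ (g : π) {σ τ : X}, σ ≤ τ → g • σ ≤ g • τ
  dim_smul : ∀ (g : π) (σ : X), dim (g • σ) = dim σ
  inc_smul : ∀ (g : π) (τ σ : X), inc (g • τ) (g • σ) = inc τ σ
  free : ∀ {g : π} {σ : X}, g • σ = σ → g = 1
  cocompact : Finite (MulAction.orbitRel.Quotient π X)

noncomputable section

/-! ### Bounded operators given by matrices -/

/-- A matrix with entries in `{-1, 0, 1}` with at most `B` nonzero entries in each row and column. -/
structure IsBoundedMatrix {ι κ : Type*} (A : κ → ι → ℤ) (B : ℕ) : Prop where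
  abs_le : ∀ k i, |A k i| ≤ 1
  row_finite : ∀ k, {i | A k i ≠ 0}.Finite
  col_finite : ∀ i, {k | A k i ≠ 0}.Finite
  row_le : ∀ k, {i | A k i ≠ 0}.ncard ≤ B
  col_le : ∀ i, {k | A k i ≠ 0}.ncard ≤ B

theorem IsBoundedMatrix.finsum_eq {ι κ : Type*} {A : κ → ι → ℤ} {B : ℕ}
    (hA : IsBoundedMatrix A B) (f : ι → ℂ) (k : κ) :
    ∑ᶠ i, (A k i : ℂ) * f i = ∑ i ∈ (hA.row_finite k).toFinset, (A k i : ℂ) * f i := by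
  apply finsum_eq_sum_of_support_subset
  intro i hi
  simp only [Function.mem_support] at hi
  simp only [Set.Finite.coe_toFinset, Set.mem_ofPred_eq]
  intro h
  apply hi
  simp [h]

theorem IsBoundedMatrix.sum_le {ι κ : Type*} {A : κ → ι → ℤ} {B : ℕ}
    (hA : IsBoundedMatrix A B) (f : lp (fun _ : ι => ℂ) 2) (s : Finset κ) :
    ∑ k ∈ s, ‖∑ᶠ i, (A k i : ℂ) * f i‖ ^ (2 : ENNReal).toReal
      ≤ ((B : ℝ) * ‖f‖) ^ (2 : ENNReal).toReal := by
  classical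
  have hf := lp.sum_rpow_le_norm_rpow (p := 2) (by norm_num) f
  have e : (2 : ENNReal).toReal = ((2 : ℕ) : ℝ) := by norm_num
  simp only [e, Real.rpow_natCast] at hf ⊢
  have h1 : ∀ k ∈ s, ‖∑ᶠ i, (A k i : ℂ) * f i‖ ^ 2
      ≤ B * ∑ i ∈ (hA.row_finite k).toFinset, ‖f i‖ ^ 2 := by
    intro k _
    rw [hA.finsum_eq]
    calc ‖∑ i ∈ (hA.row_finite k).toFinset, (A k i : ℂ) * f i‖ ^ 2
        ≤ (∑ i ∈ (hA.row_finite k).toFinset, ‖f i‖) ^ 2 := by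
          gcongr
          refine (norm_sum_le _ _).trans (Finset.sum_le_sum fun i _ => ?_)
          rw [norm_mul, Complex.norm_intCast]
          have : |(A k i : ℝ)| ≤ 1 := by exact_mod_cast hA.abs_le k i
          exact mul_le_of_le_one_left (norm_nonneg _) this
      _ ≤ (hA.row_finite k).toFinset.card * ∑ i ∈ (hA.row_finite k).toFinset, ‖f i‖ ^ 2 :=
          sq_sum_le_card_mul_sum_sq
      _ ≤ B * ∑ i ∈ (hA.row_finite k).toFinset, ‖f i‖ ^ 2 := by
          gcongr
          rw [← Set.ncard_eq_toFinset_card _ (hA.row_finite k)]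
          exact hA.row_le k
  set U := s.biUnion fun k => (hA.row_finite k).toFinset with hU
  calc ∑ k ∈ s, ‖∑ᶠ i, (A k i : ℂ) * f i‖ ^ 2
      ≤ ∑ k ∈ s, B * ∑ i ∈ (hA.row_finite k).toFinset, ‖f i‖ ^ 2 := Finset.sum_le_sum h1
    _ = B * ∑ k ∈ s, ∑ i ∈ U, if A k i ≠ 0 then ‖f i‖ ^ 2 else 0 := by
        rw [← Finset.mul_sum]
        congr 1
        refine Finset.sum_congr rfl fun k hk => ?_
        rw [← Finset.sum_filter]
        refine Finset.sum_congr ?_ fun _ _ => rfl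
        ext i
        simp only [Set.Finite.mem_toFinset, Set.mem_ofPred_eq, Finset.mem_filter, hU,
          Finset.mem_biUnion]
        exact ⟨fun h => ⟨⟨k, hk, h⟩, h⟩, fun h => h.2⟩
    _ = B * ∑ i ∈ U, ((s.filter fun k => A k i ≠ 0).card : ℝ) * ‖f i‖ ^ 2 := by
        rw [Finset.sum_comm]
        congr 1
        refine Finset.sum_congr rfl fun i _ => ?_
        rw [← Finset.sum_filter, Finset.sum_const, nsmul_eq_mul]
    _ ≤ B * ∑ i ∈ U, (B : ℝ) * ‖f i‖ ^ 2 := by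
        gcongr with i _
        refine le_trans ?_ (hA.col_le i)
        rw [Set.ncard_eq_toFinset_card _ (hA.col_finite i)]
        apply Finset.card_le_card
        intro k
        simp
    _ ≤ (B * ‖f‖) ^ 2 := by
        rw [← Finset.mul_sum, mul_pow]
        have := mul_le_mul_of_nonneg_left (hf U) (sq_nonneg (B : ℝ))
        nlinarith

/-- The bounded operator `ℓ²(ι) → ℓ²(κ)` with `(A f)(k) = ∑ i, A k i * f i`. -/
def IsBoundedMatrix.toCLM {ι κ : Type*} {A : κ → ι → ℤ} {B : ℕ} (hA : IsBoundedMatrix A B) :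
    lp (fun _ : ι => ℂ) 2 →L[ℂ] lp (fun _ : κ => ℂ) 2 :=
  LinearMap.mkContinuous
    { toFun := fun f => ⟨fun k => ∑ᶠ i, (A k i : ℂ) * f i, memℓp_gen' (hA.sum_le f)⟩
      map_add' := fun f g => by
        ext k
        change ∑ᶠ i, (A k i : ℂ) * (f i + g i)
          = ∑ᶠ i, (A k i : ℂ) * f i + ∑ᶠ i, (A k i : ℂ) * g i
        rw [hA.finsum_eq (fun i => f i + g i), hA.finsum_eq f, hA.finsum_eq g,
          ← Finset.sum_add_distrib]
        simp only [mul_add]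
      map_smul' := fun c f => by
        ext k
        change ∑ᶠ i, (A k i : ℂ) * (c * f i) = c * ∑ᶠ i, (A k i : ℂ) * f i
        rw [hA.finsum_eq (fun i => c * f i), hA.finsum_eq f, Finset.mul_sum]
        simp only [mul_left_comm] } B fun f => by
    exact lp.norm_le_of_forall_sum_le (by norm_num) (by positivity) (hA.sum_le f)

namespace PolyhedralComplex

variable {X : Type*} [PartialOrder X] {n : ℕ} (K : PolyhedralComplex X n)

/-- The `k`-dimensional cells. -/
abbrev Cells (k : ℕ) : Type _ := {σ : X // K.dim σ = k}

/-- `σ` is a hyperface of `τ`. -/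
def IsHyperface (σ τ : X) : Prop := σ < τ ∧ K.dim τ = K.dim σ + 1

/-- `N`-regularity in dimension `n`: each `(n-1)`-cell has exactly `N` hyperfaces. -/
def IsRegular (N : ℕ) : Prop :=
  ∀ σ : X, K.dim σ + 1 = n → {ν | K.IsHyperface ν σ}.ncard = N

/-- Each `(n-1)`-cell lies in the boundary of exactly two `n`-cells. -/
def NonsingularInCodimOne : Prop :=
  ∀ σ : X, K.dim σ + 1 = n → {τ | K.IsHyperface σ τ}.ncard = 2

/-- Any two hyperfaces of an `n`-cell have a common hyperface. -/
def HyperfacesMeet : Prop :=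
  ∀ τ σ σ' : X, K.dim τ = n → K.IsHyperface σ τ → K.IsHyperface σ' τ → σ ≠ σ' →
    ∃ ν, K.IsHyperface ν σ ∧ K.IsHyperface ν σ'

/-- Two cells of the same dimension form an admissible pair if they share a hyperface and are not
hyperfaces of the same cell. -/
def Admissible (σ τ : X) : Prop :=
  K.dim σ = K.dim τ ∧ (∃ ν, K.IsHyperface ν σ ∧ K.IsHyperface ν τ) ∧
    ¬∃ ρ, K.IsHyperface σ ρ ∧ K.IsHyperface τ ρ

/-- The orientations of an admissible pair are compatible if the common hyperface appears with
opposite signs in the two boundaries. -/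
def Compatible (σ τ : X) : Prop :=
  ∃ ν, K.IsHyperface ν σ ∧ K.IsHyperface ν τ ∧ K.inc σ ν = -K.inc τ ν

/-- Closed geodesic paths `(γ 0, …, γ (m - 1))` of length `m` along `k`-cells, that is, marked
closed geodesics, which are primitive: they have no nontrivial period. -/
def PrimitivePath (k : ℕ) (m : ℕ) : Type _ :=
  {γ : ZMod m → X // (∀ i, K.dim (γ i) = k) ∧ (∀ i, K.Admissible (γ i) (γ (i + 1))) ∧
    ∀ j : ZMod m, (∀ i, γ (i + j) = γ i) → j = 0}

/-- The number of non compatible consecutive pairs in a closed path. -/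
def reversingNumber {m : ℕ} (γ : ZMod m → X) : ℕ :=
  {i | ¬K.Compatible (γ i) (γ (i + 1))}.ncard

theorem reversingNumber_rotate {m : ℕ} (γ : ZMod m → X) (j : ZMod m) :
    K.reversingNumber (fun i => γ (i + j)) = K.reversingNumber γ := by
  refine Set.ncard_congr (fun i _ => i + j) ?_ ?_ ?_
  · intro i hi
    have : i + 1 + j = i + j + 1 := by ring
    simpa [this] using hi
  · intro a b _ _ h
    simpa using h
  · intro b hb
    refine ⟨b - j, ?_, by ring⟩
    have h1 : b - j + 1 + j = b + 1 := by ring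
    simpa [h1] using hb

end PolyhedralComplex

namespace CocompactPolyhedralComplex

variable {π X : Type*} [Group π] [PartialOrder X] [MulAction π X] {n : ℕ}
  (K : CocompactPolyhedralComplex π X n)

/-! ### Local finiteness, and boundedness of the boundary operator -/

theorem lt_smul (K : CocompactPolyhedralComplex π X n) (g : π) {σ τ : X} (h : σ < τ) :
    g • σ < g • τ :=
  lt_of_le_of_ne (K.smul_le_smul g h.le) fun e => h.ne (MulAction.injective g e)

theorem lt_smul_iff (K : CocompactPolyhedralComplex π X n) (g : π) {σ τ : X} :
    g • σ < g • τ ↔ σ < τ :=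
  ⟨fun h => by simpa using K.lt_smul g⁻¹ h, K.lt_smul g⟩

theorem isHyperface_smul (g : π) {σ τ : X} :
    K.IsHyperface (g • σ) (g • τ) ↔ K.IsHyperface σ τ := by
  simp [PolyhedralComplex.IsHyperface, K.lt_smul_iff, K.dim_smul]

theorem compatible_smul (g : π) {σ τ : X} :
    K.Compatible (g • σ) (g • τ) ↔ K.Compatible σ τ := by
  constructor
  · rintro ⟨ν, h1, h2, h3⟩
    obtain ⟨ν, rfl⟩ := MulAction.surjective g ν
    exact ⟨ν, (K.isHyperface_smul g).1 h1, (K.isHyperface_smul g).1 h2, by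
      simpa [K.inc_smul] using h3⟩
  · rintro ⟨ν, h1, h2, h3⟩
    exact ⟨g • ν, (K.isHyperface_smul g).2 h1, (K.isHyperface_smul g).2 h2, by
      simpa [K.inc_smul] using h3⟩

/-- Flags `ρ ≤ τ` with `τ` in a fixed set of representatives of the orbits. -/
abbrev Flags (_ : CocompactPolyhedralComplex π X n) : Type _ :=
  Σ ω : MulAction.orbitRel.Quotient π X, Set.Iic (Quotient.out ω)

theorem finite_flags : Finite K.Flags := by
  have := K.cocompact
  have : ∀ ω : MulAction.orbitRel.Quotient π X, Finite (Set.Iic (Quotient.out ω)) :=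
    fun ω => (K.finite_faces _).to_subtype
  infer_instance

/-- The chosen representative of the orbit of a cell. -/
def rep (π : Type*) {X : Type*} [Group π] [MulAction π X] (τ : X) : X :=
  Quotient.out (Quotient.mk (MulAction.orbitRel π X) τ)

theorem exists_smul_rep {π X : Type*} [Group π] [MulAction π X] (τ : X) : ∃ g : π, g • rep π τ = τ :=
  MulAction.orbitRel_apply.1 ((MulAction.orbitRel π X).symm (Quotient.mk_out _))

/-- An element of `π` carrying the representative of the orbit of a cell to that cell. -/
def shift (π : Type*) {X : Type*} [Group π] [MulAction π X] (τ : X) : π :=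
  (exists_smul_rep (π := π) τ).choose

theorem shift_smul_rep {π X : Type*} [Group π] [MulAction π X] (τ : X) : shift π τ • rep π τ = τ :=
  (exists_smul_rep (π := π) τ).choose_spec

/-- The flag of representatives in the orbit of the flag `σ ≤ τ`. -/
def toFlag {σ τ : X} (h : σ ≤ τ) : K.Flags :=
  ⟨Quotient.mk (MulAction.orbitRel π X) τ, ⟨(shift π τ)⁻¹ • σ, by
    have h2 := K.smul_le_smul (shift π τ)⁻¹ h
    have h3 : (shift π τ)⁻¹ • τ = rep π τ := inv_smul_eq_iff.2 (shift_smul_rep τ).symm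
    rwa [h3] at h2⟩⟩

theorem exists_smul_of_toFlag_eq {σ τ σ' τ' : X} {h : σ ≤ τ} {h' : σ' ≤ τ'}
    (e : K.toFlag h = K.toFlag h') : ∃ g : π, g • σ = σ' ∧ g • τ = τ' := by
  have e1 : rep π τ = rep π τ' := congrArg (fun x : K.Flags => Quotient.out x.1) e
  have e2 : (shift π τ)⁻¹ • σ = (shift π τ')⁻¹ • σ' :=
    congrArg (fun x : K.Flags => (x.2 : X)) e
  refine ⟨shift π τ' * (shift π τ)⁻¹, ?_, ?_⟩
  · rw [mul_smul, e2, smul_inv_smul]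
  · rw [mul_smul, inv_smul_eq_iff.2 (shift_smul_rep τ).symm, e1, shift_smul_rep]

theorem ncard_le_flags {s : Set X} (φ : s → K.Flags) (hφ : Function.Injective φ) :
    s.Finite ∧ s.ncard ≤ Nat.card K.Flags := by
  have := K.finite_flags
  exact ⟨Finite.of_injective φ hφ, Nat.card_le_card_of_injective φ hφ⟩

theorem faces_le (τ : X) : (Set.Iic τ).Finite ∧ (Set.Iic τ).ncard ≤ Nat.card K.Flags := by
  refine K.ncard_le_flags (fun σ => K.toFlag σ.2) ?_
  rintro ⟨σ, h⟩ ⟨σ', h'⟩ e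
  obtain ⟨g, h1, h2⟩ := K.exists_smul_of_toFlag_eq e
  obtain rfl := K.free h2
  simpa using h1

theorem cofaces_le (σ : X) : (Set.Ici σ).Finite ∧ (Set.Ici σ).ncard ≤ Nat.card K.Flags := by
  refine K.ncard_le_flags (fun τ => K.toFlag τ.2) ?_
  rintro ⟨σ, h⟩ ⟨σ', h'⟩ e
  obtain ⟨g, h1, h2⟩ := K.exists_smul_of_toFlag_eq e
  obtain rfl := K.free h1
  simpa using h2

/-- The matrix of the boundary operator from `k`-chains to `l`-chains. -/
def incMatrix (k l : ℕ) : K.Cells l → K.Cells k → ℤ := fun σ τ => K.inc τ σ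

theorem lt_of_inc_ne_zero {τ σ : X} (h : K.inc τ σ ≠ 0) : σ < τ := by
  by_contra h'
  exact h (K.inc_eq_zero fun h'' => h' h''.1)

theorem isBoundedMatrix (k l : ℕ) : IsBoundedMatrix (K.incMatrix k l) (Nat.card K.Flags) := by
  have row : ∀ σ : K.Cells l, Subtype.val '' {τ | K.incMatrix k l σ τ ≠ 0} ⊆ Set.Ici σ.1 := by
    rintro σ _ ⟨τ, h, rfl⟩
    exact (K.lt_of_inc_ne_zero h).le
  have col : ∀ τ : K.Cells k, Subtype.val '' {σ | K.incMatrix k l σ τ ≠ 0} ⊆ Set.Iic τ.1 := by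
    rintro τ _ ⟨σ, h, rfl⟩
    exact (K.lt_of_inc_ne_zero h).le
  refine ⟨fun σ τ => ?_, fun σ => ?_, fun τ => ?_, fun σ => ?_, fun τ => ?_⟩
  · unfold incMatrix
    by_cases h : σ.1 < τ.1 ∧ K.dim τ.1 = K.dim σ.1 + 1
    · rcases K.inc_hyperface h.1 h.2 with h | h <;> simp [h]
    · simp [K.inc_eq_zero h]
  · exact ((K.cofaces_le σ.1).1.subset (row σ)).of_finite_image Subtype.val_injective.injOn
  · exact ((K.faces_le τ.1).1.subset (col τ)).of_finite_image Subtype.val_injective.injOn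
  · rw [← Set.ncard_image_of_injective _ Subtype.val_injective]
    exact (Set.ncard_le_ncard (row σ) (K.cofaces_le σ.1).1).trans (K.cofaces_le σ.1).2
  · rw [← Set.ncard_image_of_injective _ Subtype.val_injective]
    exact (Set.ncard_le_ncard (col τ) (K.faces_le τ.1).1).trans (K.faces_le τ.1).2

/-! ### The `L²`-chain complex, the Laplacian and the `L²`-Betti numbers -/

/-- The space of `L²`-chains of degree `k`: the Hilbert space with orthonormal basis the
`k`-cells. -/
abbrev L2Chains (k : ℕ) : Type _ := lp (fun _ : K.Cells k => ℂ) 2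

/-- The component of the boundary operator from `k`-chains to `l`-chains; it is zero unless
`k = l + 1`. -/
def boundary (k l : ℕ) : K.L2Chains k →L[ℂ] K.L2Chains l := (K.isBoundedMatrix k l).toCLM

/-- The combinatorial Laplacian `∂ ∂* + ∂* ∂` on `L²`-chains of degree `k` (for `k = 0` the second
summand vanishes). -/
def laplacian (k : ℕ) : K.L2Chains k →L[ℂ] K.L2Chains k :=
  K.boundary (k + 1) k ∘L ContinuousLinearMap.adjoint (K.boundary (k + 1) k) +
    ContinuousLinearMap.adjoint (K.boundary k (k - 1)) ∘L K.boundary k (k - 1)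

/-- The orbits of `k`-cells, that is, the `k`-cells of the quotient complex. -/
def CellOrbits (k : ℕ) : Type _ :=
  Quotient ((MulAction.orbitRel π X).comap (Subtype.val : K.Cells k → X))

/-- The number `c_k` of `k`-cells of the quotient complex. -/
def numCells (k : ℕ) : ℕ := Nat.card (K.CellOrbits k)

open scoped Classical in
/-- The von Neumann trace: the sum of the diagonal entries at a set of representatives of the orbits
of `k`-cells (a finite sum). -/
def vnTrace {k : ℕ} (P : K.L2Chains k →L[ℂ] K.L2Chains k) : ℂ :=
  ∑ᶠ ω : K.CellOrbits k,
    inner ℂ (lp.single 2 (Quotient.out ω) (1 : ℂ) : K.L2Chains k)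
      (P (lp.single 2 (Quotient.out ω) (1 : ℂ)))

/-- The von Neumann dimension of a closed subspace: the trace of its orthogonal projection. -/
def vnDim {k : ℕ} (F : Submodule ℂ (K.L2Chains k)) [F.HasOrthogonalProjection] : ℝ :=
  (K.vnTrace F.starProjection).re

/-- The `k`-th `L²`-Betti number. -/
def l2Betti (k : ℕ) : ℝ := K.vnDim (K.laplacian k).ker

/-! ### Closed geodesics and the zeta function -/

/-- Two primitive closed geodesic paths of length `m` along `k`-cells are identified if they differ
by a cyclic permutation and the action of an element of `π`. -/
def pathSetoid (k m : ℕ) : Setoid (K.PrimitivePath k m) where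
  r γ γ' := ∃ (g : π) (j : ZMod m), ∀ i, γ'.1 i = g • γ.1 (i + j)
  iseqv :=
    { refl := fun γ => ⟨1, 0, by simp⟩
      symm := by
        rintro γ γ' ⟨g, j, h⟩
        exact ⟨g⁻¹, -j, fun i => by simp [h]⟩
      trans := by
        rintro γ γ' γ'' ⟨g, j, h⟩ ⟨g', j', h'⟩
        exact ⟨g' * g, j' + j, fun i => by rw [h', h, mul_smul, add_assoc]⟩ }

/-- The `π`-orbits of primitive closed geodesics (of any length) along `k`-cells. Each of them is
represented by a primitive closed geodesic path which starts in a given fundamental domain. -/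
def PrimitiveGeodesic (k : ℕ) : Type _ := Σ m : ℕ+, Quotient (K.pathSetoid k m)

/-- The order of the stabilizer in `π` of the closed geodesic (up to cyclic permutation) defined by
a path. It is `1` if `π` is torsion free. -/
def stabOrder (π : Type*) {X : Type*} [Group π] [MulAction π X] {m : ℕ} (γ : ZMod m → X) : ℕ :=
  Nat.card {g : π // ∃ j : ZMod m, ∀ i, g • γ i = γ (i + j)}

/-- The Euler factor `(1 - ε_γ z ^ |γ|) ^ (1 / r_γ)`, where `ε_γ` is the reversing index and `r_γ`
is the order of the stabilizer of `γ` (principal branch of the power; `r_γ = 1` if `π` is torsion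
free). -/
def pathFactor (z : ℂ) {m : ℕ} (γ : ZMod m → X) : ℂ :=
  (1 - (-1) ^ K.reversingNumber γ * z ^ m) ^ (1 / (stabOrder π γ : ℂ))

theorem reversingNumber_smul {m : ℕ} (g : π) (γ : ZMod m → X) :
    K.reversingNumber (fun i => g • γ i) = K.reversingNumber γ := by
  simp [PolyhedralComplex.reversingNumber, K.compatible_smul]

theorem stabOrder_smul_rotate {π X : Type*} [Group π] [MulAction π X] {m : ℕ} (g : π) (j : ZMod m) (γ : ZMod m → X) :
    stabOrder π (fun i => g • γ (i + j)) = stabOrder π γ := by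
  refine Nat.card_congr ((MulAut.conj g⁻¹).toEquiv.subtypeEquiv fun a => ?_)
  refine exists_congr fun b => ?_
  constructor
  · intro h i
    have := h (i - j)
    have e : i - j + b + j = i + b := by ring
    simp only [sub_add_cancel, e] at this
    simp [mul_smul, this]
  · intro h i
    have := h (i + j)
    have e : i + b + j = i + j + b := by ring
    simp only [e]
    simp [mul_smul] at this
    rw [← this, smul_inv_smul]

/-- The Euler factor of a primitive closed geodesic. -/
def eulerFactor (k : ℕ) (z : ℂ) : K.PrimitiveGeodesic k → ℂ := fun γ =>
  Quotient.lift (s := K.pathSetoid k γ.1) (fun p => K.pathFactor z p.1) (by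
    rintro p q ⟨g, j, h⟩
    have : q.1 = fun i => g • p.1 (i + j) := funext h
    have h1 : K.reversingNumber q.1 = K.reversingNumber p.1 := by
      rw [this]
      exact (K.reversingNumber_smul g fun i => p.1 (i + j)).trans (K.reversingNumber_rotate p.1 j)
    have h2 : stabOrder π q.1 = stabOrder π p.1 := by
      rw [this, stabOrder_smul_rotate]
    simp only [pathFactor, h1, h2]) γ.2

/-- The combinatorial zeta function: the product of the Euler factors of the primitive closed
geodesics along the `(n-1)`-cells. -/
def zeta (z : ℂ) : ℂ := ∏' γ : K.PrimitiveGeodesic (n - 1), K.eulerFactor (n - 1) z γ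

end CocompactPolyhedralComplex

end

/-! In codimension one the Laplacian is `(N + 2) - A`, where `A` has as entries the signs of the
admissible pairs (`laplacian_entry`). The diagonal counts two cofaces and `N` faces; for two
hyperfaces of a common `n`-cell the contributions of `∂∂*` and `∂*∂` cancel because `∂ ∘ ∂ = 0`;
only admissible pairs remain.

Hence the von Neumann trace of `A ^ m` is the signed count of closed walks of length `m` based at
representatives of the cell orbits. Each such walk is a power of a primitive one, and the orbit of a
primitive geodesic of length `d` with stabilizer of order `r` contains exactly `d / r` based paths
(`card_fiber_mul_stabOrder`). Expanding the logarithms of the Euler factors gives, near `0`, `ζ(z) =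
exp(-∑_{m ≥ 1} tr(A ^ m) z ^ m / m)`, so `ζ` determines the traces of all positive powers of `A`,
while the zeroth power has trace `c_{n-1}` (`eventually_hasProd_eulerFactor`,
`vnTrace_pow_eq_geodesicSum`, `eq_of_exp_eq_exp`).

Thus the traces of all polynomials in the Laplacian are known. For small `c > 0` the operator `1 -
cΔ` is a contraction with fixed space `ker Δ`, so by the mean ergodic theorem the averages of its
powers converge strongly to the projection onto `ker Δ`. The trace is a finite sum of matrix
coefficients, so the traces of the averages converge to the `L²`-Betti number
(`tendsto_vnTrace_average`). Nothing about the spectrum near `0` is used, hence no determinant-class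
condition. -/

/-! ### Walks with finitely many neighbours at each vertex -/

section Walks

variable {X : Type*}

/-- The sequence `x, q 0, q 1, …`. -/
def consSeq (x : X) (q : ℕ → X) : ℕ → X
  | 0 => x
  | i + 1 => q i

theorem consSeq_injective (x : X) : Function.Injective (consSeq x) := fun _ _ h =>
  funext fun i => congrFun h (i + 1)

/-- The weight of the first `m` steps of a path. -/
def pathWeight (w : X → X → ℂ) (m : ℕ) (q : ℕ → X) : ℂ :=
  ∏ i ∈ Finset.range m, w (q i) (q (i + 1))

theorem pathWeight_consSeq (w : X → X → ℂ) (m : ℕ) (x : X) (q : ℕ → X) :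
    pathWeight w (m + 1) (consSeq x q) = w x (q 0) * pathWeight w m q := by
  rw [pathWeight, Finset.prod_range_succ', mul_comm]
  rfl

theorem pathWeight_mul {w : X → X → ℂ} {d : ℕ} {q : ℕ → X} (hq : ∀ i, q (i + d) = q i) (s : ℕ) :
    pathWeight w (d * s) q = pathWeight w d q ^ s := by
  have h : ∀ s i, q (d * s + i) = q i := by
    intro s
    induction s with
    | zero => simp
    | succ s ih =>
      intro i
      rw [← ih i, ← hq (d * s + i)]
      congr 1
      ring
  induction s with
  | zero => simp [pathWeight]
  | succ s ih =>
    rw [pow_succ, ← ih, Nat.mul_succ]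
    unfold pathWeight
    rw [Finset.prod_range_add]
    congr 1
    exact Finset.prod_congr rfl fun i _ => by rw [h, add_assoc, h]

open scoped Classical in
/-- The entries of the `m`-th power of the matrix with entries `w x y` for `y ∈ nb x`. -/
noncomputable def walkSum (nb : X → Finset X) (w : X → X → ℂ) : ℕ → X → X → ℂ
  | 0, x, y => if x = y then 1 else 0
  | m + 1, x, y => ∑ z ∈ nb x, w x z * walkSum nb w m z y

open scoped Classical in
/-- The walks of length `m` from `x` to `y`, prolonged by the constant value `y`. -/
noncomputable def walks (nb : X → Finset X) : ℕ → X → X → Finset (ℕ → X)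
  | 0, x, y => if x = y then {fun _ => y} else ∅
  | m + 1, x, y => (nb x).biUnion fun z => (walks nb m z y).image (consSeq x)

theorem mem_walks {nb : X → Finset X} {m : ℕ} {x y : X} {q : ℕ → X} :
    q ∈ walks nb m x y ↔ q 0 = x ∧ (∀ i, m ≤ i → q i = y) ∧ ∀ i < m, q (i + 1) ∈ nb (q i) := by
  classical
  induction m generalizing x q with
  | zero =>
    rw [walks]
    split_ifs with h
    · simp only [Finset.mem_singleton]
      constructor
      · rintro rfl
        simp [h]
      · rintro ⟨-, h2, -⟩
        exact funext fun i => h2 i (Nat.zero_le _)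
    · simp only [Finset.notMem_empty, false_iff]
      rintro ⟨h1, h2, -⟩
      exact h (h1.symm.trans (h2 0 le_rfl))
  | succ m ih =>
    rw [walks]
    simp only [Finset.mem_biUnion, Finset.mem_image, ih]
    constructor
    · rintro ⟨z, hz, r, ⟨h1, h2, h3⟩, rfl⟩
      refine ⟨rfl, ?_, ?_⟩
      · rintro (_ | i) hi
        · omega
        · exact h2 i (by omega)
      · rintro (_ | i) hi
        · change r 0 ∈ nb x
          rwa [h1]
        · exact h3 i (by omega)
    · rintro ⟨rfl, h2, h3⟩
      refine ⟨q 1, h3 0 (by omega), fun i => q (i + 1), ⟨rfl, fun i hi => h2 _ (by omega),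
        fun i hi => h3 _ (by omega)⟩, ?_⟩
      funext i
      cases i <;> rfl

theorem disjoint_walks_image [DecidableEq (ℕ → X)] (nb : X → Finset X) (m : ℕ) (x y : X)
    (s : Set X) :
    s.PairwiseDisjoint fun z => (walks nb m z y).image (consSeq x) := by
  intro z _ z' _ hz
  rw [Function.onFun, Finset.disjoint_left]
  intro q h1 h2
  obtain ⟨p, hp, rfl⟩ := Finset.mem_image.1 h1
  obtain ⟨p', hp', e⟩ := Finset.mem_image.1 h2
  obtain rfl := consSeq_injective x e
  exact hz ((mem_walks.1 hp).1.symm.trans (mem_walks.1 hp').1)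

theorem walkSum_eq_sum_walks (nb : X → Finset X) (w : X → X → ℂ) (m : ℕ) (x y : X) :
    walkSum nb w m x y = ∑ q ∈ walks nb m x y, pathWeight w m q := by
  classical
  induction m generalizing x with
  | zero =>
    rw [walkSum, walks]
    split_ifs <;> simp [pathWeight]
  | succ m ih =>
    rw [walkSum, walks, Finset.sum_biUnion (by
      convert disjoint_walks_image nb m x y _)]
    refine Finset.sum_congr rfl fun z _ => ?_
    rw [Finset.sum_image (consSeq_injective x).injOn, ih, Finset.mul_sum]
    refine Finset.sum_congr rfl fun q hq => ?_
    rw [pathWeight_consSeq, (mem_walks.1 hq).1]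

theorem card_walks_le {nb : X → Finset X} {D : ℕ} (hD : ∀ x, (nb x).card ≤ D) (m : ℕ) (x y : X) :
    (walks nb m x y).card ≤ D ^ m := by
  classical
  induction m generalizing x with
  | zero =>
    rw [walks]
    split_ifs <;> simp
  | succ m ih =>
    rw [walks, pow_succ']
    refine (Finset.card_biUnion_le_card_mul _ _ _ fun z _ =>
      Finset.card_image_le.trans (ih z)).trans ?_
    exact Nat.mul_le_mul_right _ (hD x)

open scoped Classical in
/-- The closed paths of length `m` starting at `x`, prolonged periodically. -/
noncomputable def closedPaths (nb : X → Finset X) (m : ℕ) (x : X) : Finset (ℕ → X) :=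
  (walks nb m x x).image fun q i => q (i % m)

theorem periodize_injOn (nb : X → Finset X) {m : ℕ} (x : X) :
    Set.InjOn (fun (q : ℕ → X) i => q (i % m)) (walks nb m x x : Set (ℕ → X)) := by
  intro p hp q hq e
  rw [Finset.mem_coe, mem_walks] at hp hq
  funext i
  by_cases hi : i < m
  · simpa [Nat.mod_eq_of_lt hi] using congrFun e i
  · rw [hp.2.1 i (by omega), hq.2.1 i (by omega)]

theorem mem_closedPaths {nb : X → Finset X} {m : ℕ} (hm : 0 < m) {x : X} {p : ℕ → X} :
    p ∈ closedPaths nb m x ↔ p 0 = x ∧ (∀ i, p (i + m) = p i) ∧ ∀ i, p (i + 1) ∈ nb (p i) := by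
  classical
  rw [closedPaths, Finset.mem_image]
  constructor
  · rintro ⟨q, hq, rfl⟩
    obtain ⟨h1, h2, h3⟩ := mem_walks.1 hq
    refine ⟨by simpa using h1, fun i => by simp, fun i => ?_⟩
    have hi : i % m < m := Nat.mod_lt _ hm
    have := h3 (i % m) hi
    rcases Nat.lt_or_ge (i % m + 1) m with h | h
    · have e : (i + 1) % m = i % m + 1 := by
        rw [← Nat.mod_add_mod, Nat.mod_eq_of_lt h]
      simpa [e] using this
    · have h' : i % m + 1 = m := by omega
      have e : (i + 1) % m = 0 := by
        rw [← Nat.mod_add_mod, h', Nat.mod_self]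
      simp only [e, h1]
      rwa [h2 _ h] at this
  · rintro ⟨rfl, h2, h3⟩
    have hmod : ∀ i, p (i % m) = p i := by
      intro i
      exact (Function.Periodic.map_mod_nat (f := p) h2 i)
    refine ⟨fun i => if i < m then p i else p 0, mem_walks.2 ⟨by simp, ?_, ?_⟩, ?_⟩
    · intro i hi
      simp [not_lt.2 hi]
    · intro i hi
      have : (if i + 1 < m then p (i + 1) else p 0) = p (i + 1) := by
        split_ifs with h
        · rfl
        · rw [show i + 1 = 0 + m by omega, h2]
      simp only [hi, if_true, this, h3]
    · funext i
      simp [Nat.mod_lt i hm, hmod]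

theorem walkSum_eq_sum_closedPaths (nb : X → Finset X) (w : X → X → ℂ) {m : ℕ} (x : X) :
    walkSum nb w m x x = ∑ p ∈ closedPaths nb m x, pathWeight w m p := by
  classical
  rw [walkSum_eq_sum_walks, closedPaths, Finset.sum_image (periodize_injOn nb x)]
  refine Finset.sum_congr rfl fun q hq => Finset.prod_congr rfl fun i hi => ?_
  obtain ⟨h1, h2, h3⟩ := mem_walks.1 hq
  have hi := Finset.mem_range.1 hi
  simp only [Nat.mod_eq_of_lt hi]
  rcases Nat.lt_or_ge (i + 1) m with h | h
  · rw [Nat.mod_eq_of_lt h]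
  · rw [show i + 1 = m by omega, Nat.mod_self, h1, h2 m le_rfl]

theorem card_closedPaths_le {nb : X → Finset X} {D : ℕ} (hD : ∀ x, (nb x).card ≤ D) (m : ℕ)
    (x : X) : (closedPaths nb m x).card ≤ D ^ m := by
  classical
  exact Finset.card_image_le.trans (card_walks_le hD m x x)

/-- The shift of sequences. -/
def shiftSeq (p : ℕ → X) : ℕ → X := fun i => p (i + 1)

theorem shiftSeq_iterate (m : ℕ) (p : ℕ → X) : shiftSeq^[m] p = fun i => p (i + m) := by
  induction m generalizing p with
  | zero => rfl
  | succ m ih =>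
    rw [Function.iterate_succ_apply, ih]
    funext i
    simp [shiftSeq, add_assoc]

theorem isPeriodicPt_shiftSeq {m : ℕ} {p : ℕ → X} :
    Function.IsPeriodicPt shiftSeq m p ↔ ∀ i, p (i + m) = p i := by
  rw [Function.IsPeriodicPt, Function.IsFixedPt, shiftSeq_iterate, funext_iff]

open scoped Classical in
/-- The closed paths of length `d` starting at `x` which have no smaller period. -/
noncomputable def primitivePaths (nb : X → Finset X) (d : ℕ) (x : X) : Finset (ℕ → X) :=
  (closedPaths nb d x).filter fun p => Function.minimalPeriod shiftSeq p = d

/-- Closed paths of length `m` are sorted by their minimal period `d` under the shift. It divides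
`m`, and the path is then a primitive one of length `d` run through `m / d` times. -/
theorem walkSum_eq_sum_primitivePaths (nb : X → Finset X) (w : X → X → ℂ) {m : ℕ} (hm : 0 < m)
    (x : X) : walkSum nb w m x x =
      ∑ d ∈ m.divisors, ∑ p ∈ primitivePaths nb d x, pathWeight w d p ^ (m / d) := by
  classical
  rw [walkSum_eq_sum_closedPaths, ← Finset.sum_fiberwise_of_maps_to
    (g := fun p => Function.minimalPeriod shiftSeq p) (t := m.divisors)]
  · refine Finset.sum_congr rfl fun d hd => ?_
    have hdm := Nat.dvd_of_mem_divisors hd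
    have hd0 : 0 < d := Nat.pos_of_dvd_of_pos hdm hm
    refine Finset.sum_congr ?_ ?_
    · ext p
      simp only [primitivePaths, Finset.mem_filter, mem_closedPaths hm, mem_closedPaths hd0]
      refine and_congr_left fun h => and_congr_right fun _ => and_congr_left fun _ => ?_
      rw [← isPeriodicPt_shiftSeq, ← isPeriodicPt_shiftSeq]
      constructor
      · intro _
        rw [← h]
        exact Function.isPeriodicPt_minimalPeriod _ _
      · intro h'
        exact h'.trans_dvd hdm
    · intro p hp
      simp only [primitivePaths, Finset.mem_filter, mem_closedPaths hd0] at hp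
      rw [← pathWeight_mul hp.1.2.1, Nat.mul_div_cancel' hdm]
  · intro p hp
    rw [Nat.mem_divisors]
    exact ⟨(isPeriodicPt_shiftSeq.2 ((mem_closedPaths hm).1 hp).2.1).minimalPeriod_dvd, hm.ne'⟩

end Walks

/-! ### Incidence signs and the matrix of the Laplacian in codimension one. -/

noncomputable section

namespace PolyhedralComplex

variable {X : Type*} [PartialOrder X] {n : ℕ} (K : PolyhedralComplex X n)

theorem inc_sq {τ σ : X} (h : K.IsHyperface σ τ) : K.inc τ σ * K.inc τ σ = 1 := by
  rcases K.inc_hyperface h.1 h.2 with h | h <;> simp [h]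

theorem inc_ne_zero_iff {τ σ : X} : K.inc τ σ ≠ 0 ↔ K.IsHyperface σ τ := by
  constructor
  · intro h
    by_contra h'
    exact h (K.inc_eq_zero h')
  · intro h
    rcases K.inc_hyperface h.1 h.2 with h | h <;> simp [h]

theorem eq_of_le_of_dim_eq {σ τ : X} (h : σ ≤ τ) (hd : K.dim σ = K.dim τ) : σ = τ := by
  by_contra hne
  exact absurd hd (K.dim_lt (lt_of_le_of_ne h hne)).ne

/-- Distinct cells of the same dimension share at most one hyperface. -/
theorem common_hyperface_unique {σ τ ν ν' : X} (hne : σ ≠ τ) (hd : K.dim σ = K.dim τ)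
    (h1 : K.IsHyperface ν σ) (h2 : K.IsHyperface ν τ) (h1' : K.IsHyperface ν' σ)
    (h2' : K.IsHyperface ν' τ) : ν = ν' := by
  -- The intersection `μ` of the two cells is a proper face of `σ`, so a common hyperface, being
  -- contained in `μ`, equals it by dimension.
  obtain ⟨μ, ⟨hμσ, hμτ⟩, hμ⟩ := K.exists_inter h1.1.le h2.1.le
  rw [Set.mem_Iic] at hμσ hμτ
  have hlt : μ < σ := lt_of_le_of_ne hμσ fun e => by
    subst e
    exact hne (K.eq_of_le_of_dim_eq hμτ hd)
  have key : ∀ κ, K.IsHyperface κ σ → K.IsHyperface κ τ → κ = μ := fun κ h h' => by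
    have hle : κ ≤ μ := hμ ⟨h.1.le, h'.1.le⟩
    by_contra hk
    have := K.dim_lt (lt_of_le_of_ne hle hk)
    have := K.dim_lt hlt
    have := h.2
    omega
  rw [key ν h1 h2, key ν' h1' h2']

/-- Distinct cells are hyperfaces of at most one common cell. -/
theorem common_coface_unique {σ τ ρ ρ' : X} (hne : σ ≠ τ) (h1 : K.IsHyperface σ ρ)
    (h2 : K.IsHyperface τ ρ) (h1' : K.IsHyperface σ ρ') (h2' : K.IsHyperface τ ρ') : ρ = ρ' := by
  by_contra hρ
  refine hne (K.common_hyperface_unique (σ := ρ) (τ := ρ') hρ ?_ h1 h1' h2 h2')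
  rw [h1.2, h1'.2]

/-- Two hyperfaces of a cell meeting in a common hyperface induce opposite signs. -/
theorem inc_mul_inc_add {ρ σ τ ν : X} (hne : σ ≠ τ) (hσ : K.IsHyperface σ ρ)
    (hτ : K.IsHyperface τ ρ) (hνσ : K.IsHyperface ν σ) (hντ : K.IsHyperface ν τ) :
    K.inc ρ σ * K.inc ρ τ + K.inc σ ν * K.inc τ ν = 0 := by
  have hcard := K.diamond (hνσ.1.trans hσ.1).le (by rw [hσ.2, hνσ.2])
  have hfin : (Set.Ioo ν ρ).Finite := (K.finite_faces ρ).subset fun x hx => hx.2.le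
  -- By `diamond` nothing but `σ` and `τ` lies between `ν` and `ρ`, so the coefficient of `ν` in
  -- `∂∂ρ` has only two terms.
  have hpair : ({σ, τ} : Set X) = Set.Ioo ν ρ := by
    refine Set.eq_of_subset_of_ncard_le ?_ ?_ hfin
    · rintro x (rfl | rfl)
      exacts [⟨hνσ.1, hσ.1⟩, ⟨hντ.1, hτ.1⟩]
    · rw [hcard, Set.ncard_pair hne]
  have hsum := K.boundary_boundary ρ ν
  classical
  rw [finsum_eq_sum_of_support_subset (s := {σ, τ}), Finset.sum_pair hne] at hsum
  · rcases K.inc_hyperface hσ.1 hσ.2 with h1 | h1 <;>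
    rcases K.inc_hyperface hτ.1 hτ.2 with h2 | h2 <;>
    rcases K.inc_hyperface hνσ.1 hνσ.2 with h3 | h3 <;>
    rcases K.inc_hyperface hντ.1 hντ.2 with h4 | h4 <;>
    simp_all
  · intro x hx
    rw [Function.mem_support, mul_ne_zero_iff, K.inc_ne_zero_iff, K.inc_ne_zero_iff] at hx
    have : x ∈ ({σ, τ} : Set X) := hpair ▸ ⟨hx.2.1, hx.1.1⟩
    simpa using this

open scoped Classical in
/-- The sign attached to an admissible pair. -/
def pairSign (σ τ : X) : ℂ := if K.Compatible σ τ then 1 else -1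

/-- The common hyperface is unique, so compatibility can be tested on any given one. The sign is
then minus the entry of `∂*∂`. -/
theorem pairSign_eq {σ τ ν : X} (hne : σ ≠ τ) (hd : K.dim σ = K.dim τ)
    (h1 : K.IsHyperface ν σ) (h2 : K.IsHyperface ν τ) :
    K.pairSign σ τ = -((K.inc σ ν : ℂ) * K.inc τ ν) := by
  have hc : K.Compatible σ τ ↔ K.inc σ ν = -K.inc τ ν := by
    constructor
    · rintro ⟨ν', h1', h2', h⟩
      rwa [K.common_hyperface_unique hne hd h1 h2 h1' h2']
    · exact fun h => ⟨ν, h1, h2, h⟩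
  rw [pairSign, hc]
  rcases K.inc_hyperface h1.1 h1.2 with h | h <;>
    rcases K.inc_hyperface h2.1 h2.2 with h' | h' <;> simp [h, h']

end PolyhedralComplex

namespace CocompactPolyhedralComplex

variable {π X : Type*} [Group π] [PartialOrder X] [MulAction π X] {n : ℕ}
  (K : CocompactPolyhedralComplex π X n)

theorem finite_admissible (σ : X) : {τ | K.Admissible σ τ}.Finite := by
  refine ((K.faces_le σ).1.biUnion fun ν _ => (K.cofaces_le ν).1).subset ?_
  rintro τ ⟨-, ⟨ν, h1, h2⟩, -⟩
  exact Set.mem_biUnion (x := ν) h1.1.le h2.1.le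

open scoped Classical in
/-- The cells forming an admissible pair with a given `k`-cell. -/
def neighbors (k : ℕ) (σ : X) : Finset X :=
  if K.dim σ = k then (K.finite_admissible σ).toFinset else ∅

theorem mem_neighbors {k : ℕ} {σ τ : X} :
    τ ∈ K.neighbors k σ ↔ K.dim σ = k ∧ K.Admissible σ τ := by
  rw [neighbors]
  split_ifs with h <;> simp [h]

/-- The bound is uniform in the cell. It makes the number of closed walks grow at most
exponentially, which gives the Euler product a positive radius of convergence. -/
theorem card_neighbors_le (k : ℕ) (σ : X) :
    (K.neighbors k σ).card ≤ Nat.card K.Flags * Nat.card K.Flags := by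
  classical
  have h : K.neighbors k σ ⊆ (K.faces_le σ).1.toFinset.biUnion
      fun ν => (K.cofaces_le ν).1.toFinset := by
    intro τ hτ
    obtain ⟨-, -, ⟨ν, h1, h2⟩, -⟩ := K.mem_neighbors.1 hτ
    simp only [Finset.mem_biUnion, Set.Finite.mem_toFinset]
    exact ⟨ν, h1.1.le, h2.1.le⟩
  refine (Finset.card_le_card h).trans ((Finset.card_biUnion_le_card_mul _ _ _ fun ν _ => ?_).trans
    (Nat.mul_le_mul_right _ ?_))
  · rw [← Set.ncard_eq_toFinset_card _ (K.cofaces_le ν).1]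
    exact (K.cofaces_le ν).2
  · rw [← Set.ncard_eq_toFinset_card _ (K.faces_le σ).1]
    exact (K.faces_le σ).2

open scoped Classical in
/-- The `k`-chain given by a single cell. -/
abbrev single {k : ℕ} (σ : K.Cells k) : K.L2Chains k := lp.single 2 σ (1 : ℂ)

theorem inner_single {k : ℕ} (σ : K.Cells k) (f : K.L2Chains k) :
    inner ℂ (K.single σ) f = f σ := by
  classical
  rw [lp.inner_single_left]
  simp

theorem single_apply {k : ℕ} (σ τ : K.Cells k) [Decidable (τ = σ)] :
    K.single σ τ = if τ = σ then 1 else 0 := by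
  classical
  rw [lp.single_apply, Pi.single_apply]
  congr

theorem boundary_single {k l : ℕ} (τ : K.Cells k) (σ : K.Cells l) :
    K.boundary k l (K.single τ) σ = K.inc τ.1 σ.1 := by
  classical
  change ∑ᶠ i, (K.incMatrix k l σ i : ℂ) * K.single τ i = _
  rw [finsum_eq_single _ τ]
  · rw [single_apply]
    simp [incMatrix]
  · intro i hi
    rw [single_apply]
    simp [hi]

theorem adjoint_boundary_single {k l : ℕ} (σ : K.Cells l) (τ : K.Cells k) :
    ContinuousLinearMap.adjoint (K.boundary k l) (K.single σ) τ = K.inc τ.1 σ.1 := by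
  rw [← inner_single, ContinuousLinearMap.adjoint_inner_right, ← inner_conj_symm, inner_single,
    boundary_single]
  simp

/-- The sums may run over all cells because incidence numbers vanish off neighbouring dimensions.
This also covers `k = 0`, where `k - 1 = 0` and the second sum is zero. -/
theorem laplacian_single (k : ℕ) (τ σ : K.Cells k) :
    K.laplacian k (K.single τ) σ = ∑' ρ : X, (K.inc ρ σ.1 * K.inc ρ τ.1 : ℂ)
      + ∑' ν : X, (K.inc σ.1 ν * K.inc τ.1 ν : ℂ) := by
  rw [← inner_single, laplacian, add_apply, inner_add_right]
  congr 1
  · rw [ContinuousLinearMap.comp_apply, ← ContinuousLinearMap.adjoint_inner_left,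
      lp.inner_eq_tsum]
    simp only [adjoint_boundary_single]
    rw [← Subtype.val_injective.tsum_eq (f := fun ρ : X => (K.inc ρ σ.1 * K.inc ρ τ.1 : ℂ))
      (g := (Subtype.val : K.Cells (k + 1) → X))]
    · simp [mul_comm]
    · intro ρ hρ
      have h : K.inc ρ σ.1 ≠ 0 := fun h => hρ (by simp [h])
      have := (K.inc_ne_zero_iff.1 h).2
      exact ⟨⟨ρ, by rw [this, σ.2]⟩, rfl⟩
  · rw [ContinuousLinearMap.comp_apply, ContinuousLinearMap.adjoint_inner_right,
      lp.inner_eq_tsum]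
    simp only [boundary_single]
    rw [← Subtype.val_injective.tsum_eq (f := fun ν : X => (K.inc σ.1 ν * K.inc τ.1 ν : ℂ))
      (g := (Subtype.val : K.Cells (k - 1) → X))]
    · simp [mul_comm]
    · intro ν hν
      have h : K.inc σ.1 ν ≠ 0 := fun h => hν (by simp [h])
      have := (K.inc_ne_zero_iff.1 h).2
      exact ⟨⟨ν, by rw [σ.2] at this; omega⟩, rfl⟩

end CocompactPolyhedralComplex

theorem tsum_eq_ncard {ι : Type*} {s : Set ι} (hs : s.Finite) {f : ι → ℂ}
    (h1 : ∀ i ∈ s, f i = 1) (h0 : ∀ i ∉ s, f i = 0) : ∑' i, f i = s.ncard := by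
  rw [tsum_eq_sum (s := hs.toFinset) fun i hi => h0 i (by simpa using hi),
    Finset.sum_congr rfl fun i hi => h1 i (by simpa using hi)]
  simp [Set.ncard_eq_toFinset_card _ hs]

namespace CocompactPolyhedralComplex

variable {π X : Type*} [Group π] [PartialOrder X] [MulAction π X] {n : ℕ}
  (K : CocompactPolyhedralComplex π X n)

theorem tsum_coface_eq {σ τ ρ : X} (hne : σ ≠ τ) (h1 : K.IsHyperface σ ρ)
    (h2 : K.IsHyperface τ ρ) :
    ∑' ρ : X, (K.inc ρ σ * K.inc ρ τ : ℂ) = K.inc ρ σ * K.inc ρ τ := by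
  refine tsum_eq_single ρ fun ρ' hρ' => ?_
  by_contra h
  simp only [mul_eq_zero, Int.cast_eq_zero, not_or, K.inc_ne_zero_iff] at h
  exact hρ' (K.common_coface_unique hne h.1 h.2 h1 h2)

theorem tsum_coface_eq_zero {σ τ : X} (h : ¬∃ ρ, K.IsHyperface σ ρ ∧ K.IsHyperface τ ρ) :
    ∑' ρ : X, (K.inc ρ σ * K.inc ρ τ : ℂ) = 0 := by
  refine (tsum_congr fun ρ => ?_).trans tsum_zero
  by_contra h'
  simp only [mul_eq_zero, Int.cast_eq_zero, not_or, K.inc_ne_zero_iff] at h'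
  exact h ⟨ρ, h'⟩

theorem tsum_face_eq {σ τ ν : X} (hne : σ ≠ τ) (hd : K.dim σ = K.dim τ)
    (h1 : K.IsHyperface ν σ) (h2 : K.IsHyperface ν τ) :
    ∑' ν : X, (K.inc σ ν * K.inc τ ν : ℂ) = K.inc σ ν * K.inc τ ν := by
  refine tsum_eq_single ν fun ν' hν' => ?_
  by_contra h
  simp only [mul_eq_zero, Int.cast_eq_zero, not_or, K.inc_ne_zero_iff] at h
  exact hν' (K.common_hyperface_unique hne hd h.1 h.2 h1 h2)

theorem tsum_face_eq_zero {σ τ : X} (h : ¬∃ ν, K.IsHyperface ν σ ∧ K.IsHyperface ν τ) :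
    ∑' ν : X, (K.inc σ ν * K.inc τ ν : ℂ) = 0 := by
  refine (tsum_congr fun ν => ?_).trans tsum_zero
  by_contra h'
  simp only [mul_eq_zero, Int.cast_eq_zero, not_or, K.inc_ne_zero_iff] at h'
  exact h ⟨ν, h'⟩

open scoped Classical in
/-- The matrix entries of the Laplacian in codimension one. -/
theorem laplacian_entry {k N : ℕ} (hk : k + 1 = n)
    (hK : K.NonsingularInCodimOne) (hmeet : K.HyperfacesMeet) (hN : K.IsRegular N)
    (τ σ : K.Cells k) : K.laplacian k (K.single τ) σ =
      if σ = τ then (N + 2 : ℂ) else if σ.1 ∈ K.neighbors k τ.1 then -K.pairSign τ σ else 0 := by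
  rw [laplacian_single]
  split_ifs with h1 h2
  · subst h1
    rw [tsum_eq_ncard (s := {ρ | K.IsHyperface σ.1 ρ}),
      tsum_eq_ncard (s := {ν | K.IsHyperface ν σ.1}),
      hK σ.1 (by rw [σ.2, hk]), hN σ.1 (by rw [σ.2, hk])]
    · push_cast; ring
    · exact (K.faces_le σ.1).1.subset fun ν h => h.1.le
    · exact fun ν h => mod_cast K.inc_sq h
    · intro ν h
      simp [not_not.1 (mt K.inc_ne_zero_iff.1 h)]
    · exact (K.cofaces_le σ.1).1.subset fun ν h => h.1.le
    · exact fun ν h => mod_cast K.inc_sq h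
    · intro ν h
      simp [not_not.1 (mt K.inc_ne_zero_iff.1 h)]
  · obtain ⟨-, hd, ⟨ν, hντ, hνσ⟩, hno⟩ := K.mem_neighbors.1 h2
    have hne : τ.1 ≠ σ.1 := fun e => h1 (Subtype.ext e.symm)
    rw [K.pairSign_eq hne hd hντ hνσ, K.tsum_face_eq hne.symm hd.symm hνσ hντ,
      K.tsum_coface_eq_zero fun ⟨ρ, h, h'⟩ => hno ⟨ρ, h', h⟩]
    ring
  · have hne : σ.1 ≠ τ.1 := fun e => h1 (Subtype.ext e)
    have hd : K.dim σ.1 = K.dim τ.1 := by rw [σ.2, τ.2]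
    by_cases hρ : ∃ ρ, K.IsHyperface σ.1 ρ ∧ K.IsHyperface τ.1 ρ
    · obtain ⟨ρ, hσ, hτ⟩ := hρ
      -- Cells with a common coface: they also share a hyperface, and the two contributions cancel.
      obtain ⟨ν, hνσ, hντ⟩ := hmeet ρ σ τ (by rw [hσ.2, σ.2, hk]) hσ hτ hne
      rw [K.tsum_coface_eq hne hσ hτ, K.tsum_face_eq hne hd hνσ hντ]
      exact mod_cast K.inc_mul_inc_add hne hσ hτ hνσ hντ
    · have hν : ¬∃ ν, K.IsHyperface ν σ.1 ∧ K.IsHyperface ν τ.1 := fun ⟨ν, h, h'⟩ =>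
        h2 (K.mem_neighbors.2 ⟨τ.2, hd.symm, ⟨ν, h', h⟩, fun ⟨ρ, g, g'⟩ => hρ ⟨ρ, g', g⟩⟩)
      rw [K.tsum_coface_eq_zero hρ, K.tsum_face_eq_zero hν, add_zero]

open scoped Classical in
/-- The basis vector of a `k`-cell (zero for cells of other dimensions). -/
def basisChain (k : ℕ) (x : X) : K.L2Chains k := if h : K.dim x = k then K.single ⟨x, h⟩ else 0

/-- The operator on `k`-chains whose matrix entries are the signs of the admissible pairs. -/
def admissibilityOperator (k N : ℕ) : K.L2Chains k →L[ℂ] K.L2Chains k :=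
  (N + 2 : ℂ) • 1 - K.laplacian k

theorem admissibilityOperator_single {k N : ℕ} (hk : k + 1 = n)
    (hK : K.NonsingularInCodimOne) (hmeet : K.HyperfacesMeet) (hN : K.IsRegular N)
    (τ : K.Cells k) : K.admissibilityOperator k N (K.single τ) =
      ∑ σ ∈ K.neighbors k τ.1, K.pairSign τ σ • K.basisChain k σ := by
  classical
  ext σ
  have hl : K.admissibilityOperator k N (K.single τ) σ =
      (N + 2 : ℂ) * K.single τ σ - K.laplacian k (K.single τ) σ := rfl
  have hr : (∑ ρ ∈ K.neighbors k τ.1, K.pairSign τ ρ • K.basisChain k ρ) σ =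
      if σ.1 ∈ K.neighbors k τ.1 then K.pairSign τ σ else 0 := by
    rw [← inner_single, inner_sum]
    simp only [inner_smul_right, inner_single]
    rw [← Finset.sum_ite_eq]
    refine Finset.sum_congr rfl fun ρ hρ => ?_
    obtain ⟨hd, ha, -⟩ := K.mem_neighbors.1 hρ
    rw [basisChain, dif_pos (ha.symm.trans hd), single_apply]
    by_cases h : σ.1 = ρ <;> simp [h, Subtype.ext_iff]
  rw [hl, hr, K.laplacian_entry hk hK hmeet hN, single_apply]
  -- A cell is not admissible with itself, since it lies in the boundary of some `n`-cell. So `A`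
  -- has zero diagonal.
  have hself : σ = τ → σ.1 ∉ K.neighbors k τ.1 := by
    rintro rfl h
    obtain ⟨-, -, -, h'⟩ := K.mem_neighbors.1 h
    have := hK σ.1 (by rw [σ.2, hk])
    obtain ⟨ρ, hρ⟩ := Set.nonempty_of_ncard_ne_zero (this.trans_ne two_ne_zero)
    exact h' ⟨ρ, hρ, hρ⟩
  by_cases h : σ = τ
  · simp [h, show τ.1 ∉ K.neighbors k τ.1 from h ▸ hself h]
  · by_cases h' : σ.1 ∈ K.neighbors k τ.1 <;> simp [h, h']

/-- The matrix entries of the powers of the admissibility operator count signed walks. -/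
theorem admissibilityOperator_pow {k N : ℕ} (hk : k + 1 = n)
    (hK : K.NonsingularInCodimOne) (hmeet : K.HyperfacesMeet) (hN : K.IsRegular N)
    (m : ℕ) (τ σ : K.Cells k) :
    ((K.admissibilityOperator k N ^ m) (K.single τ)) σ =
      walkSum (K.neighbors k) K.pairSign m τ σ := by
  classical
  induction m generalizing τ with
  | zero =>
    rw [pow_zero, walkSum, one_apply_eq_self, single_apply]
    simp [Subtype.ext_iff, eq_comm]
  | succ m ih =>
    rw [pow_succ, mul_apply_eq_comp, K.admissibilityOperator_single hk hK hmeet hN,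
      map_sum, ← inner_single, inner_sum, walkSum]
    refine Finset.sum_congr rfl fun ρ hρ => ?_
    obtain ⟨hd, ha, -⟩ := K.mem_neighbors.1 hρ
    rw [map_smul, inner_smul_right, inner_single, basisChain, dif_pos (ha.symm.trans hd), ih]

theorem finite_cellOrbits (k : ℕ) : Finite (K.CellOrbits k) := by
  have := K.cocompact
  let φ : K.CellOrbits k → MulAction.orbitRel.Quotient π X :=
    Quotient.lift (fun σ => Quotient.mk (MulAction.orbitRel π X) σ.1) fun _ _ h => Quotient.sound h
  refine Finite.of_injective φ ?_
  rintro ⟨σ⟩ ⟨τ⟩ h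
  exact Quotient.sound (s := (MulAction.orbitRel π X).comap Subtype.val)
    (Quotient.exact (s := MulAction.orbitRel π X) h)

theorem vnTrace_eq_sum {k : ℕ} [Fintype (K.CellOrbits k)] (P : K.L2Chains k →L[ℂ] K.L2Chains k) :
    K.vnTrace P = ∑ ω : K.CellOrbits k, P (K.single (Quotient.out ω)) (Quotient.out ω) := by
  rw [vnTrace, finsum_eq_sum_of_fintype]
  exact Finset.sum_congr rfl fun ω _ => K.inner_single _ _

theorem vnTrace_admissibilityOperator_pow {k N : ℕ} [Fintype (K.CellOrbits k)] (hk : k + 1 = n)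
    (hK : K.NonsingularInCodimOne) (hmeet : K.HyperfacesMeet) (hN : K.IsRegular N) (m : ℕ) :
    K.vnTrace (K.admissibilityOperator k N ^ m) =
      ∑ ω : K.CellOrbits k, walkSum (K.neighbors k) K.pairSign m (Quotient.out ω).1
        (Quotient.out ω).1 := by
  rw [vnTrace_eq_sum]
  exact Finset.sum_congr rfl fun ω _ => K.admissibilityOperator_pow hk hK hmeet hN m _ _

end CocompactPolyhedralComplex


/-! ### Counting orbits of primitive closed geodesics by based paths. -/

theorem periodic_val_natCast {X : Type*} {d : ℕ} {p : ℕ → X} (hp : ∀ i, p (i + d) = p i) (a : ℕ) :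
    p (a : ZMod d).val = p a := by
  rw [ZMod.val_natCast]
  exact Function.Periodic.map_mod_nat (f := p) hp a

theorem prod_range_eq_prod_zmod {d : ℕ} [NeZero d] (f : ZMod d → ℂ) :
    ∏ i ∈ Finset.range d, f i = ∏ z : ZMod d, f z := by
  refine Finset.prod_bij (fun i _ => (i : ZMod d)) (by simp) ?_ ?_ (by simp)
  · intro a ha b hb h
    rw [Finset.mem_range] at ha hb
    simpa [ZMod.val_natCast, Nat.mod_eq_of_lt, ha, hb] using congrArg ZMod.val h
  · intro z _
    exact ⟨z.val, Finset.mem_range.2 (ZMod.val_lt z), by simp⟩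

namespace PolyhedralComplex

variable {X : Type*} [PartialOrder X] {n : ℕ} (K : PolyhedralComplex X n)

theorem pathWeight_pairSign {d : ℕ} [NeZero d] (γ : ZMod d → X) :
    pathWeight K.pairSign d (fun i => γ i) = (-1) ^ K.reversingNumber γ := by
  classical
  have h := prod_range_eq_prod_zmod (d := d) fun z => K.pairSign (γ z) (γ (z + 1))
  rw [pathWeight]
  push_cast
  rw [h, reversingNumber, Set.ncard_eq_toFinset_card', Set.toFinset_ofPred]
  simp only [pairSign]
  rw [Finset.prod_ite]
  simp

end PolyhedralComplex

namespace CocompactPolyhedralComplex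

variable {π X : Type*} [Group π] [PartialOrder X] [MulAction π X] {n : ℕ}
  (K : CocompactPolyhedralComplex π X n)

theorem admissible_smul (g : π) {σ τ : X} (h : K.Admissible σ τ) :
    K.Admissible (g • σ) (g • τ) := by
  obtain ⟨h1, ⟨ν, h2, h3⟩, h4⟩ := h
  refine ⟨by rw [K.dim_smul, K.dim_smul, h1],
    ⟨g • ν, (K.isHyperface_smul g).2 h2, (K.isHyperface_smul g).2 h3⟩, ?_⟩
  rintro ⟨ρ, h5, h6⟩
  obtain ⟨ρ, rfl⟩ := MulAction.surjective g ρ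
  exact h4 ⟨ρ, (K.isHyperface_smul g).1 h5, (K.isHyperface_smul g).1 h6⟩

/-- The chosen representatives of the orbits of `k`-cells. -/
def IsRep (k : ℕ) (x : X) : Prop := ∃ ω : K.CellOrbits k, (Quotient.out ω).1 = x

theorem exists_isRep_smul {k : ℕ} {x : X} (hx : K.dim x = k) : ∃ g : π, K.IsRep k (g • x) := by
  let ω : K.CellOrbits k := Quotient.mk _ ⟨x, hx⟩
  have h : (MulAction.orbitRel π X) (Quotient.out ω).1 x :=
    Quotient.exact (s := (MulAction.orbitRel π X).comap Subtype.val) (Quotient.out_eq ω)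
  obtain ⟨g, hg⟩ := MulAction.orbitRel_apply.1 h
  exact ⟨g, ω, hg.symm⟩

/-- An orbit has a single representative, and the action is free. -/
theorem IsRep.eq_one {k : ℕ} {x : X} {g : π} {K : CocompactPolyhedralComplex π X n}
    (h : K.IsRep k x) (h' : K.IsRep k (g • x)) : g = 1 := by
  obtain ⟨ω, rfl⟩ := h
  obtain ⟨ω', h'⟩ := h'
  have : ω' = ω := by
    rw [← Quotient.out_eq ω', ← Quotient.out_eq ω]
    refine Quotient.sound ?_
    exact MulAction.orbitRel_apply.2 ⟨g, h'.symm⟩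
  subst this
  exact K.free h'.symm

/-- The primitive closed paths of length `d` along `k`-cells starting at a representative. -/
def BasedPath (k d : ℕ) : Type _ := {γ : K.PrimitivePath k d // K.IsRep k (γ.1 0)}

/-- The translate by `g` of a primitive closed path, with the starting point moved by `j` steps. -/
def movePath {k d : ℕ} (g : π) (j : ZMod d) (γ : K.PrimitivePath k d) : K.PrimitivePath k d :=
  ⟨fun i => g • γ.1 (i + j), fun i => by rw [K.dim_smul, γ.2.1],
    fun i => by
      have := K.admissible_smul g (γ.2.2.1 (i + j))
      rwa [add_right_comm] at this,
    fun a ha => γ.2.2.2 a fun i => by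
      have := MulAction.injective g (ha (i - j))
      rwa [add_right_comm, sub_add_cancel] at this⟩

theorem primitivePath_shift_inj {k d : ℕ} (γ : K.PrimitivePath k d) {a b : ZMod d}
    (h : ∀ i, γ.1 (i + a) = γ.1 (i + b)) : a = b := by
  refine sub_eq_zero.1 (γ.2.2.2 (a - b) fun i => ?_)
  have := h (i - b)
  rwa [sub_add_cancel, sub_add_eq_add_sub, add_sub_assoc] at this

/-- A `π`-orbit of primitive closed geodesics of length `d` and with stabilizer of order `r`
contains `d / r` paths starting at representatives of the orbits of cells. -/
theorem card_fiber_mul_stabOrder {k d : ℕ} [NeZero d] (γ : K.PrimitivePath k d) :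
    Nat.card {b : K.BasedPath k d // Quotient.mk (K.pathSetoid k d) b.1 = Quotient.mk _ γ}
      * stabOrder π γ.1 = d := by
  rw [stabOrder, ← Nat.card_prod]
  conv_rhs => rw [← Nat.card_zmod d]
  have hb : ∀ b : {b : K.BasedPath k d //
      Quotient.mk (K.pathSetoid k d) b.1 = Quotient.mk _ γ},
      ∃ (g : π) (j : ZMod d), ∀ i, b.1.1.1 i = g • γ.1 (i + j) := fun b =>
    Quotient.exact (s := K.pathSetoid k d) b.2.symm
  choose G J hGJ using hb
  let S := {g : π // ∃ j : ZMod d, ∀ i, g • γ.1 i = γ.1 (i + j)}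
  have hs : ∀ h : S, ∃ j : ZMod d, ∀ i, h.1 • γ.1 i = γ.1 (i + j) := fun h => h.2
  choose I hI using hs
  -- A pair `(b, h)` satisfies `b i = (G b * h⁻¹) • γ (i + j)` with `j = J b + I h`. Conversely, for
  -- each starting point `j` exactly one `g` carries `γ j` to a representative; this `g` fixes `b`,
  -- and then `h`. Hence pairs correspond to elements of `ZMod d`.
  refine Nat.card_congr (Equiv.ofBijective (fun x => J x.1 + I x.2) ⟨?_, ?_⟩)
  · rintro ⟨b, h⟩ ⟨b', h'⟩ e
    dsimp only at e
    have hp : ∀ i, b'.1.1.1 i = (G b' * h'.1⁻¹ * h.1 * (G b)⁻¹) • b.1.1.1 i := by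
      intro i
      have h1 : h.1 • γ.1 (i + J b) = γ.1 (i + (J b + I h)) := by rw [hI, add_assoc]
      have h2 : h'.1 • γ.1 (i + J b') = γ.1 (i + (J b' + I h')) := by rw [hI, add_assoc]
      rw [e, ← h2] at h1
      rw [hGJ, hGJ, mul_smul, mul_smul, mul_smul, inv_smul_smul, h1, inv_smul_smul]
    have hone := IsRep.eq_one b.1.2 (by rw [← hp]; exact b'.1.2)
    have hbb : b = b' := by
      refine Subtype.ext (Subtype.ext (Subtype.ext (funext fun i => ?_)))
      rw [hp, hone, one_smul]
    subst hbb
    have hh : h = h' := by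
      refine Subtype.ext (inv_mul_eq_one.1 ?_).symm
      have : G b * (h'.1⁻¹ * h.1) * (G b)⁻¹ = 1 := by simpa [mul_assoc] using hone
      simpa using conj_eq_one_iff.1 this
    rw [hh]
  · intro j
    obtain ⟨g, hg⟩ := K.exists_isRep_smul (γ.2.1 j)
    let b : K.BasedPath k d := ⟨K.movePath g j γ, by
      change K.IsRep k (g • γ.1 (0 + j))
      rwa [zero_add]⟩
    let b' : {b : K.BasedPath k d // Quotient.mk (K.pathSetoid k d) b.1 = Quotient.mk _ γ} :=
      ⟨b, (Quotient.sound (s := K.pathSetoid k d) ⟨g, j, fun _ => rfl⟩ :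
        Quotient.mk (K.pathSetoid k d) γ = _).symm⟩
    have key : ∀ i, (g⁻¹ * G b') • γ.1 i = γ.1 (i + (j - J b')) := by
      intro i
      have h1 : g • γ.1 (i - J b' + j) = G b' • γ.1 (i - J b' + J b') := hGJ b' (i - J b')
      rw [sub_add_cancel] at h1
      rw [mul_smul, ← h1, inv_smul_smul, sub_add_eq_add_sub, add_sub_assoc]
    let h : S := ⟨g⁻¹ * G b', _, key⟩
    refine ⟨(b', h), ?_⟩
    have : I h = j - J b' := K.primitivePath_shift_inj γ fun i => by rw [← hI h i, ← key i]
    simp [this]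

theorem minimalPeriod_primitivePath {k d : ℕ} [NeZero d] (γ : K.PrimitivePath k d) :
    Function.minimalPeriod shiftSeq (fun i : ℕ => γ.1 i) = d := by
  have hd : Function.IsPeriodicPt shiftSeq d (fun i : ℕ => γ.1 i) :=
    isPeriodicPt_shiftSeq.2 fun i => by simp
  refine Nat.dvd_antisymm hd.minimalPeriod_dvd ?_
  have h := isPeriodicPt_shiftSeq.1 (Function.isPeriodicPt_minimalPeriod shiftSeq
    (fun i : ℕ => γ.1 i))
  rw [← ZMod.natCast_eq_zero_iff]
  refine γ.2.2.2 _ fun i => ?_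
  have := h i.val
  push_cast at this
  simpa using this

/-- The primitive closed path given by a periodic sequence. -/
def pathOfSeq {k d : ℕ} [NeZero d] {x : X} {p : ℕ → X}
    (hp : p ∈ primitivePaths (K.neighbors k) d x) : K.PrimitivePath k d := by
  classical
  refine ⟨fun z => p z.val, ?_⟩
  obtain ⟨hp1, hp2⟩ := Finset.mem_filter.1 hp
  obtain ⟨h1, h2, h3⟩ := (mem_closedPaths (NeZero.pos d)).1 hp1
  refine ⟨fun z => (K.mem_neighbors.1 (h3 _)).1, fun z => ?_, fun j hj => ?_⟩
  · have := (K.mem_neighbors.1 (h3 z.val)).2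
    rw [← periodic_val_natCast h2 (z.val + 1)] at this
    push_cast at this
    simpa using this
  · have hper : Function.IsPeriodicPt shiftSeq j.val p := isPeriodicPt_shiftSeq.2 fun i => by
      have := hj i
      dsimp only at this
      rw [periodic_val_natCast h2] at this
      rw [← this, ← periodic_val_natCast h2 (i + j.val)]
      simp
    have hdvd := hper.minimalPeriod_dvd
    rw [hp2] at hdvd
    exact (ZMod.val_eq_zero j).1 (Nat.eq_zero_of_dvd_of_lt hdvd (ZMod.val_lt j))

/-- Based primitive closed paths are the primitive periodic sequences starting at one of the
representatives. -/
def basedPathEquiv (k d : ℕ) [NeZero d] :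
    (Σ ω : K.CellOrbits k, primitivePaths (K.neighbors k) d (Quotient.out ω).1) ≃
      K.BasedPath k d := by
  classical
  refine Equiv.ofBijective (fun x => ⟨K.pathOfSeq x.2.2, x.1, ?_⟩) ⟨?_, ?_⟩
  · obtain ⟨hp1, hp2⟩ := Finset.mem_filter.1 x.2.2
    have := ((mem_closedPaths (NeZero.pos d)).1 hp1).1
    simp [pathOfSeq, this]
  · rintro ⟨ω, p, hp⟩ ⟨ω', p', hp'⟩ e
    obtain ⟨h1, h2, -⟩ := (mem_closedPaths (NeZero.pos d)).1 (Finset.mem_filter.1 hp).1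
    obtain ⟨h1', h2', -⟩ := (mem_closedPaths (NeZero.pos d)).1 (Finset.mem_filter.1 hp').1
    have hpp : p = p' := by
      funext i
      rw [← periodic_val_natCast h2, ← periodic_val_natCast h2']
      exact congrFun (congrArg (fun b : K.BasedPath k d => b.1.1) e) i
    subst hpp
    have : ω = ω' := by
      rw [← Quotient.out_eq ω, ← Quotient.out_eq ω', Subtype.ext (h1.symm.trans h1')]
    subst this
    rfl
  · rintro ⟨γ, ω, hω⟩
    have hp : (fun i : ℕ => γ.1 i) ∈ primitivePaths (K.neighbors k) d (Quotient.out ω).1 := by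
      refine Finset.mem_filter.2 ⟨(mem_closedPaths (NeZero.pos d)).2 ⟨by simp [hω], by simp, ?_⟩,
        K.minimalPeriod_primitivePath γ⟩
      intro i
      rw [K.mem_neighbors]
      refine ⟨γ.2.1 _, ?_⟩
      push_cast
      exact γ.2.2.1 _
    refine ⟨⟨ω, _, hp⟩, Subtype.ext (Subtype.ext (funext fun z => ?_))⟩
    simp [pathOfSeq]

theorem basedPathEquiv_apply {k d : ℕ} [NeZero d]
    (x : Σ ω : K.CellOrbits k, primitivePaths (K.neighbors k) d (Quotient.out ω).1) (i : ℕ) :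
    (K.basedPathEquiv k d x).1.1 i = x.2.1 i := by
  classical
  obtain ⟨-, h2, -⟩ := (mem_closedPaths (NeZero.pos d)).1 (Finset.mem_filter.1 x.2.2).1
  exact periodic_val_natCast h2 i

theorem finite_basedPath (k d : ℕ) [NeZero d] : Finite (K.BasedPath k d) := by
  have := K.finite_cellOrbits k
  exact Finite.of_equiv _ (K.basedPathEquiv k d)

/-- The geodesic defined by a based path. -/
def BasedPath.geodesic {K : CocompactPolyhedralComplex π X n} {k d : ℕ} (b : K.BasedPath k d) :
    Quotient (K.pathSetoid k d) :=
  Quotient.mk _ b.1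

theorem BasedPath.geodesic_surjective (k d : ℕ) :
    Function.Surjective (BasedPath.geodesic (K := K) (k := k) (d := d)) := by
  rintro ⟨γ⟩
  obtain ⟨g, hg⟩ := K.exists_isRep_smul (γ.2.1 0)
  refine ⟨⟨K.movePath g 0 γ, by simpa [movePath] using hg⟩, ?_⟩
  exact (Quotient.sound (s := K.pathSetoid k d) ⟨g, 0, fun _ => rfl⟩ :
    Quotient.mk (K.pathSetoid k d) γ = _).symm

theorem finite_geodesics (k d : ℕ) [NeZero d] : Finite (Quotient (K.pathSetoid k d)) :=
  have := K.finite_basedPath k d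
  Finite.of_surjective _ (BasedPath.geodesic_surjective K k d)

/-- The order of the stabilizer of a primitive closed geodesic. -/
def geodesicStabOrder {k d : ℕ} : Quotient (K.pathSetoid k d) → ℕ :=
  Quotient.lift (fun γ => stabOrder π γ.1) (by
    rintro p q ⟨g, j, h⟩
    have : q.1 = fun i => g • p.1 (i + j) := funext h
    rw [this, stabOrder_smul_rotate])

/-- The reversing index of a primitive closed geodesic. -/
def geodesicSign {k d : ℕ} : Quotient (K.pathSetoid k d) → ℂ :=
  Quotient.lift (fun γ => (-1) ^ K.reversingNumber γ.1) (by
    rintro p q ⟨g, j, h⟩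
    have : q.1 = fun i => g • p.1 (i + j) := funext h
    have h1 : K.reversingNumber q.1 = K.reversingNumber p.1 := by
      rw [this]
      exact (K.reversingNumber_smul g fun i => p.1 (i + j)).trans (K.reversingNumber_rotate p.1 j)
    rw [h1])

theorem eulerFactor_eq (k : ℕ) (z : ℂ) (γ : K.PrimitiveGeodesic k) :
    K.eulerFactor k z γ =
      (1 - K.geodesicSign γ.2 * z ^ (γ.1 : ℕ)) ^ (1 / (K.geodesicStabOrder γ.2 : ℂ)) := by
  obtain ⟨m, ⟨γ⟩⟩ := γ
  rfl

theorem norm_geodesicSign {k d : ℕ} (q : Quotient (K.pathSetoid k d)) :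
    ‖K.geodesicSign q‖ = 1 := by
  obtain ⟨γ⟩ := q
  change ‖((-1) ^ K.reversingNumber γ.1 : ℂ)‖ = 1
  simp

theorem card_fiber_mul_geodesicStabOrder {k d : ℕ} [NeZero d] (q : Quotient (K.pathSetoid k d)) :
    Nat.card {b : K.BasedPath k d // b.geodesic = q} * K.geodesicStabOrder q = d := by
  obtain ⟨γ⟩ := q
  exact K.card_fiber_mul_stabOrder γ

/-- As `Nat.card` of an infinite type is `0`, this includes the finiteness of the stabilizer. -/
theorem geodesicStabOrder_pos {k d : ℕ} [NeZero d] (q : Quotient (K.pathSetoid k d)) :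
    0 < K.geodesicStabOrder q :=
  Nat.pos_of_ne_zero fun h => NeZero.ne d (by
    rw [← K.card_fiber_mul_geodesicStabOrder q, h, mul_zero])

/-- The based paths are grouped by the geodesic they define. The sign is constant on each fibre, and
the fibre has `d / r` elements. -/
theorem sum_primitivePaths_eq {k d : ℕ} [NeZero d] [Fintype (K.CellOrbits k)]
    [Fintype (Quotient (K.pathSetoid k d))] (s : ℕ) :
    ∑ ω : K.CellOrbits k, ∑ p ∈ primitivePaths (K.neighbors k) d (Quotient.out ω).1,
      pathWeight K.pairSign d p ^ s =
    ∑ q : Quotient (K.pathSetoid k d), (d / K.geodesicStabOrder q : ℂ) * K.geodesicSign q ^ s := by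
  classical
  have := K.finite_basedPath k d
  have := Fintype.ofFinite (K.BasedPath k d)
  have h1 : ∀ ω : K.CellOrbits k, ∑ p ∈ primitivePaths (K.neighbors k) d (Quotient.out ω).1,
      pathWeight K.pairSign d p ^ s =
      ∑ p : primitivePaths (K.neighbors k) d (Quotient.out ω).1,
        pathWeight K.pairSign d p.1 ^ s := fun ω => (Finset.sum_coe_sort _ _).symm
  simp only [h1]
  rw [← Fintype.sum_sigma', Fintype.sum_equiv (K.basedPathEquiv k d) _
    (fun b : K.BasedPath k d => K.geodesicSign b.geodesic ^ s)]
  · rw [← Finset.sum_fiberwise Finset.univ (fun b : K.BasedPath k d => b.geodesic)]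
    refine Finset.sum_congr rfl fun q _ => ?_
    rw [Finset.sum_congr rfl (g := fun _ => K.geodesicSign q ^ s) fun b hb => by
      rw [(Finset.mem_filter.1 hb).2], Finset.sum_const, nsmul_eq_mul]
    congr 1
    have hr : (K.geodesicStabOrder q : ℂ) ≠ 0 := mod_cast (K.geodesicStabOrder_pos q).ne'
    rw [eq_div_iff hr, ← Fintype.card_subtype, ← Nat.card_eq_fintype_card]
    exact mod_cast K.card_fiber_mul_geodesicStabOrder q
  · intro x
    congr 1
    change _ = (-1 : ℂ) ^ K.reversingNumber (K.basedPathEquiv k d x).1.1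
    rw [← K.pathWeight_pairSign]
    simp only [basedPathEquiv_apply]

theorem card_geodesics_le (k d : ℕ) [NeZero d] :
    Nat.card (Quotient (K.pathSetoid k d)) ≤
      Nat.card (K.CellOrbits k) * (Nat.card K.Flags * Nat.card K.Flags) ^ d := by
  classical
  have := K.finite_basedPath k d
  have := K.finite_cellOrbits k
  have := Fintype.ofFinite (K.CellOrbits k)
  refine (Nat.card_le_card_of_surjective _ (BasedPath.geodesic_surjective K k d)).trans ?_
  rw [← Nat.card_congr (K.basedPathEquiv k d), Nat.card_sigma, Nat.card_eq_fintype_card,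
    ← smul_eq_mul, Fintype.card, ← Finset.sum_const]
  refine Finset.sum_le_sum fun ω _ => ?_
  rw [Nat.card_eq_fintype_card, Fintype.card_coe]
  exact (Finset.card_filter_le _ _).trans (card_closedPaths_le (K.card_neighbors_le k) d _)

end CocompactPolyhedralComplex


/-! ### Logarithms of Euler products and uniqueness of power series. -/

theorem summable_sigma_pow {Q : ℕ+ → Type*} [∀ d, Finite (Q d)] {C D : ℕ}
    (hQ : ∀ d : ℕ+, Nat.card (Q d) ≤ C * D ^ (d : ℕ)) {x : ℝ} (hx : 0 ≤ x) (hxD : x * D < 1) :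
    Summable fun γ : (Σ d, Q d) => x ^ (γ.1 : ℕ) := by
  have := fun d => Fintype.ofFinite (Q d)
  rw [summable_sigma_of_nonneg fun γ => by positivity]
  refine ⟨fun d => (hasSum_fintype _).summable, ?_⟩
  have hg : Summable fun d : ℕ+ => (C : ℝ) * (x * D) ^ (d : ℕ) :=
    ((summable_geometric_of_lt_one (by positivity) hxD).mul_left _).comp_injective
      PNat.coe_injective
  refine Summable.of_nonneg_of_le (fun d => tsum_nonneg fun _ => by positivity) (fun d => ?_) hg
  have h : (Nat.card (Q d) : ℝ) ≤ C * D ^ (d : ℕ) := by exact_mod_cast hQ d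
  change ∑' _ : Q d, x ^ (d : ℕ) ≤ _
  rw [tsum_fintype, Finset.sum_const, Finset.card_univ, ← Nat.card_eq_fintype_card, nsmul_eq_mul,
    mul_pow]
  nlinarith [pow_nonneg hx (d : ℕ)]

theorem hasSum_log_one_sub {w : ℂ} (hw : ‖w‖ < 1) :
    HasSum (fun s : ℕ+ => -(w ^ (s : ℕ) / s)) (Complex.log (1 - w)) := by
  have h := (Complex.hasSum_taylorSeries_neg_log hw).neg
  rw [neg_neg] at h
  rw [← PNat.coe_injective.hasSum_iff] at h
  · exact h
  · intro m hm
    have : m = 0 := by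
      by_contra h0
      exact hm ⟨⟨m, Nat.pos_of_ne_zero h0⟩, rfl⟩
    simp [this]

/-- The terms of the expansions of the logarithms of the Euler factors. -/
def logTerm {Q : ℕ → Type*} (ε : ∀ d, Q d → ℂ) (r : ∀ d, Q d → ℕ) (z : ℂ) (d : ℕ) (q : Q d)
    (s : ℕ) : ℂ :=
  (r d q : ℂ)⁻¹ * -((ε d q * z ^ d) ^ s / s)

/-- Since `(d - 1)(s - 1) ≥ 0`, we have `d s ≥ d + (s - 1)`. This separates the variables, so that
the double series is dominated by a product of two convergent series. -/
theorem norm_logTerm_le {Q : ℕ → Type*} {ε : ∀ d, Q d → ℂ} (r : ∀ d, Q d → ℕ)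
    (hε : ∀ d q, ‖ε d q‖ = 1) {z : ℂ} (hz : ‖z‖ < 1) {d s : ℕ} (hd : 0 < d) (hs : 0 < s) (q : Q d) :
    ‖logTerm ε r z d q s‖ ≤ ‖z‖ ^ d * ‖z‖ ^ (s - 1) := by
  have hr : ‖((r d q : ℂ))⁻¹‖ ≤ 1 := by
    rw [norm_inv, Complex.norm_natCast]
    exact Nat.cast_inv_le_one _
  have hs' : (1 : ℝ) ≤ s := by exact_mod_cast hs
  have hpow : ‖z‖ ^ (d * s) ≤ ‖z‖ ^ (d + (s - 1)) := by
    refine pow_le_pow_of_le_one (norm_nonneg z) hz.le ?_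
    obtain ⟨a, rfl⟩ := Nat.exists_eq_add_of_le hd
    obtain ⟨b, rfl⟩ := Nat.exists_eq_add_of_le hs
    have : 1 + b - 1 = b := by omega
    simp only [Nat.zero_add, Nat.succ_eq_add_one] at *
    rw [this]
    nlinarith [Nat.zero_le (a * b)]
  calc ‖logTerm ε r z d q s‖ = ‖((r d q : ℂ))⁻¹‖ * (‖z‖ ^ (d * s) / s) := by
        simp [logTerm, hε, pow_mul]
    _ ≤ 1 * ‖z‖ ^ (d * s) := by
        gcongr
        exact div_le_self (by positivity) hs'
    _ ≤ ‖z‖ ^ d * ‖z‖ ^ (s - 1) := by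
        rw [one_mul, ← pow_add]
        exact hpow

theorem summable_logTerm {Q : ℕ → Type*} [∀ d : ℕ+, Finite (Q d)] {C D : ℕ}
    (hQ : ∀ d : ℕ+, Nat.card (Q d) ≤ C * D ^ (d : ℕ)) {ε : ∀ d, Q d → ℂ} (r : ∀ d, Q d → ℕ)
    (hε : ∀ d q, ‖ε d q‖ = 1) {z : ℂ} (hz : ‖z‖ < 1) (hzD : ‖z‖ * D < 1) :
    Summable fun x : (Σ d : ℕ+, Q d) × ℕ+ => logTerm ε r z x.1.1 x.1.2 x.2 := by
  have h1 := summable_sigma_pow (Q := fun d => Q d) hQ (norm_nonneg z) hzD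
  have h2 : Summable fun s : ℕ+ => ‖z‖ ^ ((s : ℕ) - 1) :=
    (summable_geometric_of_lt_one (norm_nonneg z) hz).comp_injective
      (i := fun s : ℕ+ => (s : ℕ) - 1) fun a b h => by
        have := a.pos
        have := b.pos
        exact PNat.eq (by dsimp only at h; omega)
  exact Summable.of_norm_bounded (h1.mul_of_nonneg h2 (fun _ => by positivity)
    fun _ => by positivity) fun x => norm_logTerm_le r hε hz x.1.1.pos x.2.pos x.1.2

/-- With `m = d s`, the weight `1 / (r s)` of a term is `(d / r) / m`. -/
theorem sum_logTerm {Q : ℕ → Type*} (ε : ∀ d, Q d → ℂ) (r : ∀ d, Q d → ℕ) (z : ℂ) {m d s : ℕ}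
    (hd : d ≠ 0) (hs : s ≠ 0) (hm : d * s = m) [Fintype (Q d)] :
    ∑ q : Q d, logTerm ε r z d q s = -((∑' q : Q d, (d / r d q : ℂ) * ε d q ^ s) / m) * z ^ m := by
  have hd' : (d : ℂ) ≠ 0 := mod_cast hd
  have hs' : (s : ℂ) ≠ 0 := mod_cast hs
  rw [tsum_fintype, ← neg_div, ← Finset.sum_neg_distrib, Finset.sum_div, Finset.sum_mul]
  refine Finset.sum_congr rfl fun q _ => ?_
  subst hm
  rw [logTerm, mul_pow, ← pow_mul]
  push_cast
  field_simp

/-- Power series expansion of a sum of logarithms indexed by weighted primitive cycles. -/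
theorem hasSum_log_cycles {Q : ℕ → Type*} [∀ d : ℕ+, Finite (Q d)] {C D : ℕ}
    (hQ : ∀ d : ℕ+, Nat.card (Q d) ≤ C * D ^ (d : ℕ)) (ε : ∀ d, Q d → ℂ) (r : ∀ d, Q d → ℕ)
    (hε : ∀ d q, ‖ε d q‖ = 1) {z : ℂ} (hz : ‖z‖ < 1) (hzD : ‖z‖ * D < 1) :
    ∃ L : ℂ, HasSum (fun γ : (Σ d : ℕ+, Q d) =>
        (r γ.1 γ.2 : ℂ)⁻¹ * Complex.log (1 - ε γ.1 γ.2 * z ^ (γ.1 : ℕ))) L ∧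
      HasSum (fun m : ℕ => -((∑ d ∈ m.divisors, ∑' q : Q d, (d / r d q : ℂ) * ε d q ^ (m / d)) / m)
        * z ^ m) L := by
  have := fun d : ℕ+ => Fintype.ofFinite (Q d)
  have hF := (summable_logTerm hQ r hε hz hzD).hasSum
  set L := ∑' x : (Σ d : ℕ+, Q d) × ℕ+, logTerm ε r z x.1.1 x.1.2 x.2 with hL
  clear_value L
  refine ⟨L, ?_, ?_⟩
  -- The absolutely convergent double series is summed in two ways: over `s` first, which gives
  -- logarithms, and below along `d * s = m`, which gives a power series in `z`.
  · refine hF.prod_fiberwise fun γ => ?_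
    have hlt : ‖ε γ.1 γ.2 * z ^ (γ.1 : ℕ)‖ < 1 := by
      rw [norm_mul, hε, one_mul, norm_pow]
      exact pow_lt_one₀ (norm_nonneg z) hz (PNat.ne_zero γ.1)
    exact (hasSum_log_one_sub hlt).mul_left ((r γ.1 γ.2 : ℂ)⁻¹)
  · let e : (Σ p : ℕ+ × ℕ+, Q p.1) ≃ (Σ d : ℕ+, Q d) × ℕ+ :=
      { toFun := fun x => (⟨x.1.1, x.2⟩, x.1.2)
        invFun := fun x => ⟨(x.1.1, x.2), x.1.2⟩
        left_inv := fun _ => rfl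
        right_inv := fun _ => rfl }
    have h1 : HasSum (fun p : ℕ+ × ℕ+ => ∑ q : Q p.1, logTerm ε r z p.1 q p.2) L :=
      (e.hasSum_iff.2 hF).sigma fun p => hasSum_fintype _
    have h2 := (sigmaAntidiagonalEquivProd.hasSum_iff.2 h1).sigma fun m => hasSum_fintype _
    rw [← PNat.coe_injective.hasSum_iff]
    · convert h2 using 1
      funext m
      have h3 : ∀ p : Nat.divisorsAntidiagonal m,
          ((fun p : ℕ+ × ℕ+ => ∑ q : Q p.1, logTerm ε r z p.1 q p.2) ∘ sigmaAntidiagonalEquivProd)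
            ⟨m, p⟩ = -((∑' q : Q p.1.1, (p.1.1 / r p.1.1 q : ℂ) * ε p.1.1 q ^ p.1.2) / (m : ℕ))
              * z ^ (m : ℕ) := by
        intro p
        exact sum_logTerm ε r z (PNat.ne_zero _) (PNat.ne_zero _)
          (divisorsAntidiagonalFactors_eq p)
      rw [Finset.sum_congr rfl fun p _ => h3 p, ← Finset.sum_mul, Finset.sum_neg_distrib,
        ← Finset.sum_div, Function.comp_apply,
        ← Nat.sum_divisorsAntidiagonal (n := (m : ℕ))
          (fun d s => ∑' q : Q d, (d / r d q : ℂ) * ε d q ^ s),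
        ← Finset.sum_coe_sort]
    · intro m hm
      have : m = 0 := by
        by_contra h0
        exact hm ⟨⟨m, Nat.pos_of_ne_zero h0⟩, rfl⟩
      simp [this]

/-- Power series with the same constant term and with the same exponential near `0` coincide. -/
theorem eq_of_exp_eq_exp {a a' : ℕ → ℂ} (h0 : a 0 = a' 0)
    (h : ∀ᶠ z in 𝓝 (0 : ℂ), ∃ L L', HasSum (fun m => a m * z ^ m) L ∧
      HasSum (fun m => a' m * z ^ m) L' ∧ Complex.exp L = Complex.exp L') : a = a' := by
  let p := FormalMultilinearSeries.ofScalars ℂ (fun m => a m - a' m)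
  let f : ℂ → ℂ := fun z => ∑' m, (a m - a' m) * z ^ m
  have hp : HasFPowerSeriesAt f p 0 := by
    rw [hasFPowerSeriesAt_iff]
    filter_upwards [h] with z ⟨L, L', h1, h2, _⟩
    have h3 := h1.sub h2
    simp only [← sub_mul] at h3
    simpa [p, f, mul_comm] using h3.summable.hasSum
  have hf0 : f 0 = 0 := by
    have : f 0 = a 0 - a' 0 := by
      refine (tsum_eq_single 0 fun m hm => by simp [hm]).trans (by simp)
    rw [this, h0, sub_self]
  -- Exponentials determine the difference `f` only up to `2πi ℤ`; continuity and `f 0 = 0` keep its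
  -- imaginary part within `(-π, π)`, where `exp (f z) = 1` forces `f z = 0`.
  have hsmall : ∀ᶠ z in 𝓝 (0 : ℂ), ‖f z‖ < 1 := by
    have := hp.continuousAt.norm
    refine this.eventually_lt continuousAt_const ?_
    simp [hf0]
  have hzero : f =ᶠ[𝓝 0] 0 := by
    filter_upwards [h, hsmall] with z ⟨L, L', h1, h2, h3⟩ hz
    have h4 := h1.sub h2
    simp only [← sub_mul] at h4
    have h5 : f z = L - L' := h4.tsum_eq
    have h6 : Complex.exp (f z) = 1 := by
      rw [h5, Complex.exp_sub, h3, div_self (Complex.exp_ne_zero _)]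
    have hi : |(f z).im| < 1 := (Complex.abs_im_le_norm _).trans_lt hz
    have hpi := Real.pi_gt_three
    rw [abs_lt] at hi
    rw [← Complex.log_exp (x := f z) (by linarith) (by linarith), h6, Complex.log_one]
    rfl
  have hpz := (hp.congr hzero).eq_zero
  funext m
  have := congrArg (fun p : FormalMultilinearSeries ℂ ℂ ℂ => p.coeff m) hpz
  simp only [p, FormalMultilinearSeries.coeff_ofScalars] at this
  exact sub_eq_zero.1 (this.trans (by simp [FormalMultilinearSeries.coeff]))


/-! ### The zeta function, traces of powers, and the mean ergodic theorem. -/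

namespace CocompactPolyhedralComplex

variable {π X : Type*} [Group π] [PartialOrder X] [MulAction π X] {n : ℕ}
  (K : CocompactPolyhedralComplex π X n)

/-- The weighted number of orbits of closed geodesics of length `m`. -/
def geodesicSum (k m : ℕ) : ℂ :=
  ∑ d ∈ m.divisors, ∑' q : Quotient (K.pathSetoid k d),
    (d / K.geodesicStabOrder q : ℂ) * K.geodesicSign q ^ (m / d)

/-- Near `0` the Euler product converges to the exponential of a power series whose coefficients are
determined by the weighted numbers of closed geodesics. -/
theorem eventually_hasProd_eulerFactor (k : ℕ) : ∀ᶠ z in 𝓝 (0 : ℂ), ∃ L : ℂ,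
    HasProd (K.eulerFactor k z) (Complex.exp L) ∧
      HasSum (fun m : ℕ => -(K.geodesicSum k m / m) * z ^ m) L := by
  set D := Nat.card K.Flags * Nat.card K.Flags with hD
  have h1 : ∀ᶠ z in 𝓝 (0 : ℂ), ‖z‖ < 1 :=
    continuous_norm.continuousAt.eventually_lt continuousAt_const (by simp)
  have h2 : ∀ᶠ z in 𝓝 (0 : ℂ), ‖z‖ * D < 1 :=
    (continuous_norm.mul continuous_const).continuousAt.eventually_lt continuousAt_const (by simp)
  filter_upwards [h1, h2] with z hz hzD
  have := fun d : ℕ+ => K.finite_geodesics k d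
  obtain ⟨L, hL1, hL2⟩ := hasSum_log_cycles (Q := fun d => Quotient (K.pathSetoid k d))
    (C := Nat.card (K.CellOrbits k)) (D := D) (fun d => K.card_geodesics_le k d)
    (fun d q => K.geodesicSign q) (fun d q => K.geodesicStabOrder q)
    (fun d q => K.norm_geodesicSign q) hz hzD
  refine ⟨L, ?_, hL2⟩
  have hfun : K.eulerFactor k z = fun γ => Complex.exp ((K.geodesicStabOrder γ.2 : ℂ)⁻¹ *
      Complex.log (1 - K.geodesicSign γ.2 * z ^ (γ.1 : ℕ))) := funext fun γ => ?_
  · rw [hfun]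
    exact hL1.cexp
  -- The principal power is `exp` of a multiple of `log` only for a nonzero base.
  have hne : 1 - K.geodesicSign γ.2 * z ^ (γ.1 : ℕ) ≠ 0 := by
    intro h
    have h3 : ‖K.geodesicSign γ.2 * z ^ (γ.1 : ℕ)‖ = 1 := by
      rw [← sub_eq_zero.1 h, norm_one]
    rw [norm_mul, K.norm_geodesicSign, one_mul, norm_pow] at h3
    exact (pow_lt_one₀ (norm_nonneg z) hz (PNat.ne_zero γ.1)).ne h3
  rw [eulerFactor_eq, Complex.cpow_def_of_ne_zero hne, mul_comm, one_div]

/-- The von Neumann trace as a linear map. -/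
def vnTraceLinear (k : ℕ) : (K.L2Chains k →L[ℂ] K.L2Chains k) →ₗ[ℂ] ℂ :=
  have := K.finite_cellOrbits k
  letI := Fintype.ofFinite (K.CellOrbits k)
  { toFun := K.vnTrace
    map_add' := fun P Q => by
      simp only [vnTrace_eq_sum, ← Finset.sum_add_distrib]
      rfl
    map_smul' := fun c P => by
      simp only [vnTrace_eq_sum, smul_eq_mul, RingHom.id_apply, Finset.mul_sum]
      rfl }

theorem vnTraceLinear_apply {k : ℕ} (P : K.L2Chains k →L[ℂ] K.L2Chains k) :
    K.vnTraceLinear k P = K.vnTrace P := rfl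

theorem vnTrace_one (k : ℕ) : K.vnTrace (1 : K.L2Chains k →L[ℂ] K.L2Chains k) = K.numCells k := by
  classical
  have := K.finite_cellOrbits k
  have := Fintype.ofFinite (K.CellOrbits k)
  rw [vnTrace_eq_sum, numCells, Nat.card_eq_fintype_card]
  simp

/-- The trace of a power of the admissibility operator counts closed geodesics. -/
theorem vnTrace_pow_eq_geodesicSum {k N : ℕ} (hk : k + 1 = n)
    (hK : K.NonsingularInCodimOne) (hmeet : K.HyperfacesMeet) (hN : K.IsRegular N) {m : ℕ}
    (hm : 0 < m) : K.vnTrace (K.admissibilityOperator k N ^ m) = K.geodesicSum k m := by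
  have := K.finite_cellOrbits k
  have := Fintype.ofFinite (K.CellOrbits k)
  rw [K.vnTrace_admissibilityOperator_pow hk hK hmeet hN, geodesicSum]
  simp only [walkSum_eq_sum_primitivePaths _ _ hm]
  rw [Finset.sum_comm]
  refine Finset.sum_congr rfl fun d hd => ?_
  have : NeZero d := ⟨(Nat.pos_of_mem_divisors hd).ne'⟩
  have := K.finite_geodesics k d
  have := Fintype.ofFinite (Quotient (K.pathSetoid k d))
  rw [K.sum_primitivePaths_eq, tsum_fintype]

/-- This is `Δ² ≤ BΔ`, obtained from `⟨x, Δx⟩ = ‖∂*x‖² + ‖∂x‖²`; it takes the place of spectral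
theory in the contraction estimate. -/
theorem norm_laplacian_sq_le (k : ℕ) : ∃ B : ℝ, 0 ≤ B ∧ ∀ x : K.L2Chains k,
    ‖K.laplacian k x‖ ^ 2 ≤ B * (inner ℂ x (K.laplacian k x)).re := by
  set S := K.boundary (k + 1) k with hS
  set R := K.boundary k (k - 1) with hR
  refine ⟨2 * (‖S‖ ^ 2 + ‖ContinuousLinearMap.adjoint R‖ ^ 2), by positivity, fun x => ?_⟩
  set y := ContinuousLinearMap.adjoint S x with hy
  have hx : K.laplacian k x = S y + ContinuousLinearMap.adjoint R (R x) := rfl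
  have hin : (inner ℂ x (K.laplacian k x)).re = ‖y‖ ^ 2 + ‖R x‖ ^ 2 := by
    have h1 : inner ℂ x (S y) = inner ℂ y y :=
      (ContinuousLinearMap.adjoint_inner_left S y x).symm
    have h2 : inner ℂ x (ContinuousLinearMap.adjoint R (R x)) = inner ℂ (R x) (R x) :=
      ContinuousLinearMap.adjoint_inner_right R x (R x)
    rw [hx, inner_add_right, h1, h2, Complex.add_re]
    exact congrArg₂ _ (inner_self_eq_norm_sq (𝕜 := ℂ) y) (inner_self_eq_norm_sq (𝕜 := ℂ) (R x))
  have h1 : ‖K.laplacian k x‖ ≤ ‖S‖ * ‖y‖ + ‖ContinuousLinearMap.adjoint R‖ * ‖R x‖ := by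
    rw [hx]
    exact (norm_add_le _ _).trans (add_le_add (S.le_opNorm _) (ContinuousLinearMap.le_opNorm _ _))
  rw [hin]
  calc ‖K.laplacian k x‖ ^ 2
      ≤ (‖S‖ * ‖y‖ + ‖ContinuousLinearMap.adjoint R‖ * ‖R x‖) ^ 2 := by gcongr
    _ ≤ 2 * ((‖S‖ * ‖y‖) ^ 2 + (‖ContinuousLinearMap.adjoint R‖ * ‖R x‖) ^ 2) := add_sq_le
    _ ≤ _ := by
      nlinarith [mul_nonneg (sq_nonneg ‖S‖) (sq_nonneg ‖R x‖),
        mul_nonneg (sq_nonneg ‖ContinuousLinearMap.adjoint R‖) (sq_nonneg ‖y‖)]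

/-- `‖x - cΔx‖² = ‖x‖² - 2c⟨x, Δx⟩ + c²‖Δx‖² ≤ ‖x‖² - c(2 - cB)⟨x, Δx⟩`, and `cB ≤ 1`. Allowing
every `c ≤ c₀` lets two complexes share the same `c`. -/
theorem exists_norm_one_sub_laplacian_le (k : ℕ) : ∃ c₀ : ℝ, 0 < c₀ ∧ ∀ c : ℝ, 0 < c → c ≤ c₀ →
    ‖(1 : K.L2Chains k →L[ℂ] K.L2Chains k) - (c : ℂ) • K.laplacian k‖ ≤ 1 := by
  obtain ⟨B, hB, h⟩ := K.norm_laplacian_sq_le k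
  refine ⟨(B + 1)⁻¹, by positivity, fun c hc hcB => ?_⟩
  refine ContinuousLinearMap.opNorm_le_bound _ zero_le_one fun x => ?_
  rw [one_mul]
  refine le_of_sq_le_sq ?_ (norm_nonneg x)
  change ‖x - (c : ℂ) • K.laplacian k x‖ ^ 2 ≤ _
  rw [@norm_sub_sq ℂ, inner_smul_right, norm_smul, mul_pow]
  have hx := h x
  have hcB' : c * B ≤ 1 := by
    have : c * (B + 1) ≤ 1 := by
      calc c * (B + 1) ≤ (B + 1)⁻¹ * (B + 1) := by gcongr
        _ = 1 := inv_mul_cancel₀ (by positivity)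
    nlinarith
  have h0 : 0 ≤ (inner ℂ x (K.laplacian k x)).re := by
    by_contra hneg
    push Not at hneg
    have h3 : ‖K.laplacian k x‖ = 0 := by nlinarith [sq_nonneg ‖K.laplacian k x‖]
    rw [norm_eq_zero.1 h3] at hneg
    simp at hneg
  have hre : RCLike.re ((c : ℂ) * inner ℂ x (K.laplacian k x))
      = c * (inner ℂ x (K.laplacian k x)).re := by
    simp
  rw [hre, Complex.norm_real, Real.norm_eq_abs, sq_abs]
  nlinarith [mul_le_mul_of_nonneg_left hx (sq_nonneg c),
    mul_le_mul_of_nonneg_right hcB' (mul_nonneg hc.le h0), mul_nonneg hc.le h0]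

/-- The `L²`-Betti number is a limit of traces of polynomials in the Laplacian (mean ergodic theorem). -/
theorem tendsto_vnTrace_average {k : ℕ} {c : ℝ} (hc : 0 < c)
    (h : ‖(1 : K.L2Chains k →L[ℂ] K.L2Chains k) - (c : ℂ) • K.laplacian k‖ ≤ 1) :
    Filter.Tendsto (fun J : ℕ => ((J : ℂ)⁻¹ * ∑ j ∈ Finset.range J,
      K.vnTrace ((1 - (c : ℂ) • K.laplacian k) ^ j)).re) Filter.atTop (𝓝 (K.l2Betti k)) := by
  have := K.finite_cellOrbits k
  have := Fintype.ofFinite (K.CellOrbits k)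
  set f : K.L2Chains k →L[ℂ] K.L2Chains k := 1 - (c : ℂ) • K.laplacian k with hf
  have hlocus : f.eqLocus (1 : K.L2Chains k →L[ℂ] K.L2Chains k) = (K.laplacian k).ker := by
    ext x
    have hfx : f x = x - (c : ℂ) • K.laplacian k x := rfl
    have hc' : (c : ℂ) ≠ 0 := mod_cast hc.ne'
    change f x = x ↔ K.laplacian k x = 0
    rw [hfx, sub_eq_self, smul_eq_zero]
    simp [hc']
  rw [l2Betti, vnDim]
  refine (Complex.continuous_re.tendsto _).comp ?_
  simp only [vnTrace_eq_sum]
  have key : ∀ J : ℕ, (J : ℂ)⁻¹ * ∑ j ∈ Finset.range J, ∑ ω : K.CellOrbits k,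
      (f ^ j) (K.single (Quotient.out ω)) (Quotient.out ω) = ∑ ω : K.CellOrbits k,
      (birkhoffAverage ℂ f id J (K.single (Quotient.out ω)) : K.L2Chains k) (Quotient.out ω) := by
    intro J
    rw [Finset.sum_comm, Finset.mul_sum]
    refine Finset.sum_congr rfl fun ω _ => ?_
    rw [← inner_single, birkhoffAverage, birkhoffSum, inner_smul_right, inner_sum]
    congr 1
    refine Finset.sum_congr rfl fun j _ => ?_
    have hpow : (f ^ j) (K.single (Quotient.out ω)) = f^[j] (K.single (Quotient.out ω)) := by
      rw [FunLike.coe_pow_eq_iterate]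
    rw [inner_single, id, hpow]
  simp only [key]
  refine tendsto_finsetSum _ fun ω _ => ?_
  -- The convergence is only strong, which suffices for each of the finitely many diagonal
  -- coefficients.
  have ht := f.tendsto_birkhoffAverage_orthogonalProjection h (K.single (Quotient.out ω))
  have ht2 := ((innerSL ℂ (K.single (Quotient.out ω))).continuous.tendsto _).comp ht
  simp only [innerSL_apply_apply, Function.comp_def, inner_single] at ht2
  have hproj : (f.eqLocus (1 : K.L2Chains k →L[ℂ] K.L2Chains k)).starProjection =
      (K.laplacian k).ker.starProjection := by
    congr 1
  rw [← hproj]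
  exact ht2

end CocompactPolyhedralComplex

/-! ### Comparison of the two complexes. -/

theorem CocompactPolyhedralComplex.vnTrace_aeval_congr {π X π' X' : Type*} [Group π]
    [PartialOrder X] [MulAction π X] [Group π'] [PartialOrder X'] [MulAction π' X'] {n n' k k' : ℕ}
    (K : CocompactPolyhedralComplex π X n) (K' : CocompactPolyhedralComplex π' X' n')
    {A : K.L2Chains k →L[ℂ] K.L2Chains k} {A' : K'.L2Chains k' →L[ℂ] K'.L2Chains k'}
    (h : ∀ m, K.vnTrace (A ^ m) = K'.vnTrace (A' ^ m)) (p : Polynomial ℂ) :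
    K.vnTrace (Polynomial.aeval A p) = K'.vnTrace (Polynomial.aeval A' p) := by
  rw [Polynomial.aeval_eq_sum_range, Polynomial.aeval_eq_sum_range, ← vnTraceLinear_apply,
    ← vnTraceLinear_apply, map_sum, map_sum]
  refine Finset.sum_congr rfl fun i _ => ?_
  rw [map_smul, map_smul, vnTraceLinear_apply, vnTraceLinear_apply, h]

/-- The polynomial depends only on `N`, `c` and `j`, so it is the same for two complexes with equal
`N`. -/
theorem CocompactPolyhedralComplex.aeval_admissibilityOperator {π X : Type*} [Group π]
    [PartialOrder X] [MulAction π X] {n : ℕ} (K : CocompactPolyhedralComplex π X n) (k N j : ℕ)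
    (c : ℂ) : Polynomial.aeval (K.admissibilityOperator k N)
      ((Polynomial.C (1 - c * (N + 2)) + Polynomial.C c * Polynomial.X) ^ j) =
      (1 - c • K.laplacian k) ^ j := by
  rw [map_pow, map_add, map_mul, Polynomial.aeval_C, Polynomial.aeval_C, Polynomial.aeval_X,
    admissibilityOperator, Algebra.algebraMap_eq_smul_one, Algebra.algebraMap_eq_smul_one,
    smul_mul_assoc, one_mul]
  congr 1
  module

end

theorem mainTheorem5 {π X π' X' : Type*} [Group π] [PartialOrder X] [MulAction π X]
    [Group π'] [PartialOrder X'] [MulAction π' X'] {n n' N : ℕ} (hn : 2 ≤ n) (hn' : 2 ≤ n')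
    (K : CocompactPolyhedralComplex π X n) (K' : CocompactPolyhedralComplex π' X' n')
    (hK : K.NonsingularInCodimOne) (hK' : K'.NonsingularInCodimOne)
    (hmeet : K.HyperfacesMeet) (hmeet' : K'.HyperfacesMeet)
    (hN : K.IsRegular N) (hN' : K'.IsRegular N) :
    ((∀ᶠ z in 𝓝 (0 : ℂ), Multipliable (K.eulerFactor (n - 1) z)) ∧
      ∀ᶠ z in 𝓝 (0 : ℂ), Multipliable (K'.eulerFactor (n' - 1) z)) ∧
    (K.zeta =ᶠ[𝓝 0] K'.zeta → K.numCells (n - 1) = K'.numCells (n' - 1) →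
      K.l2Betti (n - 1) = K'.l2Betti (n' - 1)) := by
  have hk : n - 1 + 1 = n := by omega
  have hk' : n' - 1 + 1 = n' := by omega
  have hL := K.eventually_hasProd_eulerFactor (n - 1)
  have hL' := K'.eventually_hasProd_eulerFactor (n' - 1)
  refine ⟨⟨hL.mono fun z ⟨L, h, _⟩ => h.multipliable,
    hL'.mono fun z ⟨L, h, _⟩ => h.multipliable⟩, fun hζ hcells => ?_⟩
  have hcoeff := eq_of_exp_eq_exp
    (a := fun m => -(K.geodesicSum (n - 1) m / m)) (a' := fun m => -(K'.geodesicSum (n' - 1) m / m))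
    (by simp) (by
      filter_upwards [hL, hL', hζ] with z ⟨L, h1, h2⟩ ⟨L', h1', h2'⟩ hz
      refine ⟨L, L', h2, h2', ?_⟩
      rw [← h1.tprod_eq, ← h1'.tprod_eq]
      exact hz)
  have htr : ∀ m, K.vnTrace (K.admissibilityOperator (n - 1) N ^ m) =
      K'.vnTrace (K'.admissibilityOperator (n' - 1) N ^ m) := by
    intro m
    rcases Nat.eq_zero_or_pos m with rfl | hm
    -- The zeta function does not see the zeroth power; here the numbers of cells are needed.
    · rw [pow_zero, pow_zero, K.vnTrace_one, K'.vnTrace_one, hcells]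
    · rw [K.vnTrace_pow_eq_geodesicSum hk hK hmeet hN hm,
        K'.vnTrace_pow_eq_geodesicSum hk' hK' hmeet' hN' hm]
      have := congrFun hcoeff m
      have hm' : (m : ℂ) ≠ 0 := mod_cast hm.ne'
      exact (div_left_inj' hm').1 (neg_inj.1 this)
  obtain ⟨c₁, hc₁, h₁⟩ := K.exists_norm_one_sub_laplacian_le (n - 1)
  obtain ⟨c₂, hc₂, h₂⟩ := K'.exists_norm_one_sub_laplacian_le (n' - 1)
  have hc : 0 < min c₁ c₂ := lt_min hc₁ hc₂
  have ht := K.tendsto_vnTrace_average hc (h₁ _ hc (min_le_left _ _))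
  have ht' := K'.tendsto_vnTrace_average hc (h₂ _ hc (min_le_right _ _))
  -- With a common `c`, the two sequences of averaged traces agree term by term, so their limits do.
  refine tendsto_nhds_unique ht (ht'.congr fun J => ?_)
  congr 2
  refine Finset.sum_congr rfl fun j _ => ?_
  rw [← K.aeval_admissibilityOperator _ N, ← K'.aeval_admissibilityOperator _ N]
  exact (K.vnTrace_aeval_congr K' htr _).symm
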